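/- Let $k,l\ge 0$ be fixed integers. Consider Hamiltonians $H=\sum_{a} H_a$ on $n$ qubits, where the sum is finite and each $H_a$ is a Hermitian term acting on a set $S_a$ of at most $k$ qubits (i.e. $H$ is $k$-local), and suppose that each qubit interacts with at most $l$ other qubits: for every qubit $i$ there are at most $l$ qubits $j\neq i$ such that $\{i,j\}\subseteq S_a$ for some $a$. The input consists of $n$ in unary and the list of the terms, each given by the set $S_a$ and the matrix of $H_a$ on the qubits of $S_a$ in the computational basis; the real and imaginary parts of the matrix entries are rational numbers, given as fractions of integers in binary. Call $H$ globally stoquastic if $H$ is real and $\langle x|H|y\rangle\le 0$ for all $x\ne y$ in $\{0,1\}^n$. Then the problem $\mathsf{GlobalStoq}$ of deciding whether such an $H$ is globally stoquastic is in $\mathbf{P}$: the language of all encodings of $k$-local Hamiltonians of this kind, in which each qubit interacts with at most $l$ others and which are globally stoquastic, is decided by a deterministic Turing machine in time polynomial in the length of the input. -/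

import Mathlib

/-- A language over a finite alphabet is in `P` if its characteristic function is computed by a
(multi-stack) Turing machine in time polynomial in the length of the input word. -/
def InP {Γ : Type} [Fintype Γ] (L : Language Γ) : Prop :=
  open Classical in
  Nonempty (Turing.TM2ComputableInPolyTime (id : List Γ → List Γ) Computability.encodeBool
    (fun w => decide (w ∈ L)))

namespace LocalHam

/-- The computational basis of `n` qubits: bit strings of length `n`. -/
abbrev Bits (n : ℕ) : Type := Fin n → Fin 2

/-- A matrix in the computational basis is globally stoquastic if it is real and all its
off-diagonal entries are non-positive. -/
def GloballyStoquastic {n : ℕ} (H : Matrix (Bits n) (Bits n) ℂ) : Prop :=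
  (∀ x y, (H x y).im = 0) ∧ ∀ x y, x ≠ y → (H x y).re ≤ 0

/-- A fraction, not necessarily in lowest terms. -/
structure Frac where
  num : ℤ
  den : ℕ
  den_pos : 0 < den

/-- The rational number that a fraction denotes. -/
def Frac.val (a : Frac) : ℚ := (a.num : ℚ) / (a.den : ℚ)

/-- A complex number with rational real and imaginary parts, given by two fractions. -/
structure GaussFrac where
  re : Frac
  im : Frac

/-- The complex number that a `GaussFrac` denotes. -/
def GaussFrac.val (z : GaussFrac) : ℂ := ⟨(z.re.val : ℝ), (z.im.val : ℝ)⟩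

/-- A Hermitian term of a Hamiltonian on `n` qubits: `arity` many distinct qubits, in increasing
order, and a Hermitian matrix on these qubits. -/
structure Term (n : ℕ) where
  arity : ℕ
  site : Fin arity ↪o Fin n
  mat : Matrix (Bits arity) (Bits arity) GaussFrac
  herm : (mat.map GaussFrac.val).IsHermitian

/-- The qubits that a term acts on. -/
def Term.support {n : ℕ} (t : Term n) : Finset (Fin n) :=
  Finset.univ.map t.site.toEmbedding

/-- The operator of a term on all `n` qubits: its matrix on the qubits of its support, tensored
with the identity on all other qubits. -/
noncomputable def Term.toMatrix {n : ℕ} (t : Term n) : Matrix (Bits n) (Bits n) ℂ :=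
  fun x y =>
    if ∀ q, q ∉ t.support → x q = y q then
      (t.mat (fun i => x (t.site i)) (fun i => y (t.site i))).val
    else 0

/-- A description of a Hamiltonian on `n` qubits as a finite sum of Hermitian terms. -/
structure Hamiltonian where
  n : ℕ
  terms : List (Term n)

/-- The Hamiltonian as a matrix in the computational basis. -/
noncomputable def Hamiltonian.toMatrix (H : Hamiltonian) : Matrix (Bits H.n) (Bits H.n) ℂ :=
  (H.terms.map Term.toMatrix).sum

/-- Every term acts on at most `k` qubits. -/
def Hamiltonian.IsLocal (k : ℕ) (H : Hamiltonian) : Prop :=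
  ∀ t ∈ H.terms, t.arity ≤ k

/-- Two distinct qubits interact if some term acts on both of them. -/
def Hamiltonian.Interacts (H : Hamiltonian) (i j : Fin H.n) : Prop :=
  i ≠ j ∧ ∃ t ∈ H.terms, i ∈ t.support ∧ j ∈ t.support

/-- Every qubit interacts with at most `l` other qubits. -/
def Hamiltonian.DegreeLE (l : ℕ) (H : Hamiltonian) : Prop :=
  ∀ i : Fin H.n, {j | H.Interacts i j}.ncard ≤ l

/-- The alphabet of the input words. -/
inductive Letter where
  | zero
  | one
  | minus
  | slash
  | comma
  | bar
  deriving DecidableEq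

instance : Fintype Letter where
  elems := {Letter.zero, Letter.one, Letter.minus, Letter.slash, Letter.comma, Letter.bar}
  complete := by intro a; cases a <;> decide

/-- A binary digit as a letter. -/
def encodeBit (b : Bool) : Letter := if b then Letter.one else Letter.zero

/-- A natural number in binary, least significant digit first, without superfluous zeros. -/
def encodeNat (m : ℕ) : List Letter := (Computability.encodeNat m).map encodeBit

/-- A fraction: a minus sign if the numerator is negative, the absolute value of the numerator in
binary, a slash, the denominator in binary. -/
def Frac.encode (a : Frac) : List Letter :=
  (if a.num < 0 then [Letter.minus] else []) ++
    encodeNat a.num.natAbs ++ [Letter.slash] ++ encodeNat a.den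

/-- A complex number: its real part and its imaginary part, each followed by a comma. -/
def GaussFrac.encode (z : GaussFrac) : List Letter :=
  z.re.encode ++ [Letter.comma] ++ z.im.encode ++ [Letter.comma]

/-- The bit string with number `r`: bit `i` is the coefficient of `2 ^ i` in `r`. -/
def bitsOf {m : ℕ} (r : Fin (2 ^ m)) : Bits m := finFunctionFinEquiv.symm r

/-- A term: its support as a bit string of length `n`, a bar, the matrix entries row by row,
a bar. -/
def Term.encode {n : ℕ} (t : Term n) : List Letter :=
  (List.finRange n).map (fun q => encodeBit (decide (q ∈ t.support))) ++ [Letter.bar] ++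
    ((List.finRange (2 ^ t.arity)).flatMap fun r =>
      (List.finRange (2 ^ t.arity)).flatMap fun c => (t.mat (bitsOf r) (bitsOf c)).encode) ++
    [Letter.bar]

/-- A Hamiltonian: the number `n` of qubits in unary, a bar, the terms one after the other. -/
def Hamiltonian.encode (H : Hamiltonian) : List Letter :=
  List.replicate H.n Letter.one ++ [Letter.bar] ++ H.terms.flatMap Term.encode

/-- The decision problem of global stoquasticity for `k`-local Hamiltonians in which every qubit
interacts with at most `l` others, as the language of the encodings of its yes-instances. -/
def GlobalStoq (k l : ℕ) : Language Letter :=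
  {w | ∃ H : Hamiltonian, H.encode = w ∧ H.IsLocal k ∧ H.DegreeLE l ∧
    GloballyStoquastic H.toMatrix}

end LocalHam

/-! Locality of matrix entries. Let x ≠ y differ at qubit i. A term contributes to ⟨x|H|y⟩ only if x
and y agree off its support, so its support contains i and lies in the neighborhood N of i: the
qubits that share a term with i, including i itself. If some term contributes, x and y also agree
outside N. Replacing all bits outside N by zeros then changes neither the set of contributing terms
nor the matrix elements they supply (`Hamiltonian.toMatrix_mask`). If no term contributes, the entry
is zero. Since N has at most l + 1 elements (`Hamiltonian.degreeLE_iff`), at most n · 4^(l+1)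
entries decide stoquasticity (`globallyStoquastic_of_mask`, `forall_qubitOk_iff`). Each is a sum of
polynomially many rationals. The diagonal is real because the terms are Hermitian.

The procedure `decideStoq` also has to recognize valid inputs. A total decoder is followed by
re-encoding and comparison with the input (`decideStoq_iff`). Then canonical digits, support sizes,
matrix sizes and Hermiticity are checked, which characterizes the descriptions of actual terms
(`termOk_iff`). Sums of fractions use a common denominator that is never reduced; the lengths of the
numbers still stay linear in the input (`length_sumLoop_le`).

For the running time, data are binary trees in prefix code, and programs are structured code over
four stacks of bits. Such a program is compiled to a stack machine with the same number of steps
(`Exec.steps`). `PolyTime` bounds both the time and the size of the result, so it is closed under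
composition, pairing, conditionals, and folds whose intermediate states have polynomial size
(`PolyTime.foldl`). All routines are built from these, and `PolyTime.turing` turns the final
predicate into a machine. -/

namespace StackProg

open Turing StateTransition

/-! ### Trees and structured programs over stacks of bits -/

/-- Binary trees, the universal data type of the programs below. -/
inductive Tree where
  | nil
  | node (a b : Tree)

namespace Tree

/-- The number of nodes and leaves of a tree. -/
def size : Tree → ℕ
  | nil => 1
  | node a b => a.size + b.size + 1

/-- The prefix code of a tree. -/
def code : Tree → List Bool
  | nil => [false]
  | node a b => true :: (a.code ++ b.code)

theorem size_pos (t : Tree) : 0 < t.size := by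
  cases t <;> simp [size]

end Tree

/-- The names of the stacks of a program. -/
inductive Stk where
  | val
  | tmp
  | aux
  | cnt
  deriving DecidableEq

instance : Fintype Stk where
  elems := {Stk.val, Stk.tmp, Stk.aux, Stk.cnt}
  complete := by intro a; cases a <;> decide

/-- The contents of the stacks of a program. -/
structure Store where
  val : List Bool
  tmp : List Bool
  aux : List Bool
  cnt : List Bool

/-- The contents of one stack. -/
def Store.get (s : Store) : Stk → List Bool
  | .val => s.val
  | .tmp => s.tmp
  | .aux => s.aux
  | .cnt => s.cnt

/-- The store with the contents of one stack replaced. -/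
def Store.set (s : Store) (k : Stk) (u : List Bool) : Store :=
  match k with
  | .val => { s with val := u }
  | .tmp => { s with tmp := u }
  | .aux => { s with aux := u }
  | .cnt => { s with cnt := u }

/-- Programs that manipulate stacks of bits. `branch k p q` and `loop k p` remove the top of the
stack `k`; `branch` runs `p` if it was `true` and `q` otherwise, and `loop` runs `p` and repeats if
it was `true` and ends otherwise. -/
inductive Prog where
  | skip
  | push (k : Stk) (b : Bool)
  | seq (p q : Prog)
  | branch (k : Stk) (p q : Prog)
  | loop (k : Stk) (p : Prog)

/-- `Exec p s s' n`: started with the store `s`, the program `p` ends with the store `s'` after `n`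
steps. -/
inductive Exec : Prog → Store → Store → ℕ → Prop
  | skip (s) : Exec .skip s s 1
  | push (k b s) : Exec (.push k b) s (s.set k (b :: s.get k)) 1
  | seq {p q s s' s'' m n} : Exec p s s' m → Exec q s' s'' n → Exec (.seq p q) s s'' (m + n)
  | branch_true {k p q s s' n} : (s.get k).head? = some true →
      Exec p (s.set k (s.get k).tail) s' n → Exec (.branch k p q) s s' (n + 1)
  | branch_false {k p q s s' n} : (s.get k).head? ≠ some true →
      Exec q (s.set k (s.get k).tail) s' n → Exec (.branch k p q) s s' (n + 1)
  | loop_exit {k p s} : (s.get k).head? ≠ some true →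
      Exec (.loop k p) s (s.set k (s.get k).tail) 1
  | loop_step {k p s s' s'' m n} : (s.get k).head? = some true →
      Exec p (s.set k (s.get k).tail) s' m → Exec (.loop k p) s' s'' n →
      Exec (.loop k p) s s'' (m + n + 1)

/-! ### Compilation to stack machines -/

/-- The labels of the machine code of a program. -/
def Lab : Prog → Type
  | .skip => Unit
  | .push _ _ => Unit
  | .seq p q => Lab p ⊕ Lab q
  | .branch _ p q => Option (Lab p ⊕ Lab q)
  | .loop _ p => Option (Lab p)

/-- The first label of the machine code of a program. -/
def Lab.start : (p : Prog) → Lab p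
  | .skip => ()
  | .push _ _ => ()
  | .seq p _ => Sum.inl (start p)
  | .branch _ _ _ => none
  | .loop _ _ => none

/-- Programs have finitely many labels. -/
theorem Lab.finite : (p : Prog) → Finite (Lab p)
  | .skip => inferInstanceAs (Finite Unit)
  | .push _ _ => inferInstanceAs (Finite Unit)
  | .seq p q =>
    have := Lab.finite p
    have := Lab.finite q
    inferInstanceAs (Finite (Lab p ⊕ Lab q))
  | .branch _ p q =>
    have := Lab.finite p
    have := Lab.finite q
    inferInstanceAs (Finite (Option (Lab p ⊕ Lab q)))
  | .loop _ p =>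
    have := Lab.finite p
    inferInstanceAs (Finite (Option (Lab p)))

/-- The alphabets of the stacks of the machine: an input stack over `A`, and stacks of bits. -/
def Alph (A : Type) : Option Stk → Type
  | none => A
  | some _ => Bool

/-- The internal states of the machine: a bit and possibly an input letter. -/
abbrev St (A : Type) : Type := Bool × Option A

section Compile

variable {A Λ : Type}

/-- The statement that removes the top of a stack of bits and jumps according to it. -/
def popGoto (k : Stk) (l₁ l₂ : Λ) : TM2.Stmt (Alph A) Λ (St A) :=
  .pop (some k) (fun v o => (decide ((show Option Bool from o) = some true), v.2))
    (.goto fun v => if v.1 then l₁ else l₂)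

/-- The machine code of a program whose labels are embedded into `Λ` by `e`, and that jumps to `x`
at the end. -/
def stmts : (p : Prog) → (e : Lab p → Λ) → (x : Λ) → Lab p → TM2.Stmt (Alph A) Λ (St A)
  | .skip, _, x, _ => .goto fun _ => x
  | .push k b, _, x, _ => .push (some k) (fun _ => b) (.goto fun _ => x)
  | .seq p q, e, x, a =>
    match (show Lab p ⊕ Lab q from a) with
    | .inl a => stmts p (fun c => e (Sum.inl c)) (e (Sum.inr (Lab.start q))) a
    | .inr a => stmts q (fun c => e (Sum.inr c)) x a
  | .branch k p q, e, x, a =>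
    match (show Option (Lab p ⊕ Lab q) from a) with
    | none => popGoto k (e (some (Sum.inl (Lab.start p)))) (e (some (Sum.inr (Lab.start q))))
    | some (.inl a) => stmts p (fun c => e (some (Sum.inl c))) x a
    | some (.inr a) => stmts q (fun c => e (some (Sum.inr c))) x a
  | .loop k p, e, x, a =>
    match (show Option (Lab p) from a) with
    | none => popGoto k (e (some (Lab.start p))) x
    | some a => stmts p (fun c => e (some c)) (e none) a

/-- The stacks of the machine. -/
def contents (u : List A) (s : Store) : ∀ k, List (Alph A k)
  | none => u
  | some k => s.get k

theorem update_contents (u : List A) (s : Store) (k : Stk) (l : List Bool) :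
    Function.update (contents u s) (some k) l = contents u (s.set k l) := by
  funext k'
  rcases k' with _ | k'
  · rfl
  · cases k <;> cases k' <;> rfl

/-- `Steps f n a b`: exactly `n` steps lead from `a` to `b`. -/
def Steps {C : Type} (f : C → Option C) (n : ℕ) (a b : C) : Prop :=
  (flip bind f)^[n] (some a) = some b

theorem Steps.one {C : Type} {f : C → Option C} {a b : C} (h : f a = some b) : Steps f 1 a b := h

theorem Steps.trans {C : Type} {f : C → Option C} {m n : ℕ} {a b c : C} (h₁ : Steps f m a b)
    (h₂ : Steps f n b c) : Steps f (m + n) a c := by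
  unfold Steps at *
  rw [add_comm, Function.iterate_add_apply, h₁, h₂]

/-- A jump can depend only on the internal state, so the popped bit is first stored there. An empty
stack counts as `false`. -/
theorem step_popGoto {M : Λ → TM2.Stmt (Alph A) Λ (St A)} {l l₁ l₂ : Λ} {k : Stk}
    (hM : M l = popGoto k l₁ l₂) (v : St A) (u : List A) (s : Store) :
    ∃ v', Steps (TM2.step M) 1 ⟨some l, v, contents u s⟩
      ⟨some (if (s.get k).head? = some true then l₁ else l₂), v',
        contents u (s.set k (s.get k).tail)⟩ := by
  refine ⟨(decide ((s.get k).head? = some true), v.2), Steps.one ?_⟩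
  rw [← update_contents, TM2.step, hM]
  have h : (if decide ((s.get k).head? = some true) = true then l₁ else l₂) =
      if (s.get k).head? = some true then l₁ else l₂ := by simp only [decide_eq_true_eq]
  rw [← h]
  rfl

/-- Every rule of `Exec` charges one unit for exactly one machine step. The label embedding and the
exit label are arbitrary so that the induction applies to subprograms: the first half of a sequence
exits to the second, and a loop body exits to the test of its loop. -/
theorem Exec.steps {p : Prog} {s s' : Store} {n : ℕ} (h : Exec p s s' n) (u : List A)
    (M : Λ → TM2.Stmt (Alph A) Λ (St A)) (e : Lab p → Λ) (x : Λ)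
    (hM : ∀ a, M (e a) = stmts p e x a) (v : St A) :
    ∃ v', Steps (TM2.step M) n ⟨some (e (Lab.start p)), v, contents u s⟩
      ⟨some x, v', contents u s'⟩ := by
  induction h generalizing x v with
  | skip s =>
    refine ⟨v, Steps.one ?_⟩
    rw [TM2.step, hM]
    rfl
  | push k b s =>
    refine ⟨v, Steps.one ?_⟩
    rw [← update_contents, TM2.step, hM]
    rfl
  | @seq p q s s' s'' m n _ _ ih₁ ih₂ =>
    obtain ⟨v₁, h₁⟩ := ih₁ (fun c => e (Sum.inl c)) (e (Sum.inr (Lab.start q)))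
      (fun a => hM (Sum.inl a)) v
    obtain ⟨v₂, h₂⟩ := ih₂ (fun c => e (Sum.inr c)) x (fun a => hM (Sum.inr a)) v₁
    exact ⟨v₂, h₁.trans h₂⟩
  | @branch_true k p q s s' n hk _ ih =>
    obtain ⟨v₁, h₁⟩ := step_popGoto (hM none) v u s
    rw [if_pos hk] at h₁
    obtain ⟨v₂, h₂⟩ := ih (fun c => e (some (Sum.inl c))) x (fun a => hM (some (Sum.inl a))) v₁
    exact ⟨v₂, by rw [add_comm]; exact h₁.trans h₂⟩
  | @branch_false k p q s s' n hk _ ih =>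
    obtain ⟨v₁, h₁⟩ := step_popGoto (hM none) v u s
    rw [if_neg hk] at h₁
    obtain ⟨v₂, h₂⟩ := ih (fun c => e (some (Sum.inr c))) x (fun a => hM (some (Sum.inr a))) v₁
    exact ⟨v₂, by rw [add_comm]; exact h₁.trans h₂⟩
  | @loop_exit k p s hk =>
    obtain ⟨v₁, h₁⟩ := step_popGoto (hM none) v u s
    rw [if_neg hk] at h₁
    exact ⟨v₁, h₁⟩
  | @loop_step k p s s' s'' m n hk _ _ ih₁ ih₂ =>
    obtain ⟨v₁, h₁⟩ := step_popGoto (hM none) v u s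
    rw [if_pos hk] at h₁
    obtain ⟨v₂, h₂⟩ := ih₁ (fun c => e (some c)) (e none) (fun a => hM (some a)) v₁
    obtain ⟨v₃, h₃⟩ := ih₂ e x hM v₂
    exact ⟨v₃, by rw [add_comm]; exact h₁.trans (h₂.trans h₃)⟩

end Compile

end StackProg

/-! ### Polynomial-time functions on encoded data -/

namespace StackProg

open Turing StateTransition

/-- Coefficients in `ℕ` make time bounds monotone, so a size estimate may be substituted into them.
-/
theorem eval_mono (q : Polynomial ℕ) {m n : ℕ} (h : m ≤ n) : q.eval m ≤ q.eval n := by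
  rw [Polynomial.eval_eq_sum, Polynomial.eval_eq_sum]
  exact Finset.sum_le_sum fun i _ => Nat.mul_le_mul_left _ (Nat.pow_le_pow_left h i)

/-- Types whose elements are represented by trees. -/
class Enc (α : Type) where
  enc : α → Tree

open Enc (enc)

/-- The size of the representation of an element. -/
def esize {α : Type} [Enc α] (a : α) : ℕ := (enc a).size

/-- The store with all stacks empty except for the value stack. -/
def top (u : List Bool) : Store := ⟨u, [], [], []⟩

/-- A function is computed by a program in polynomial time, on top of the value stack. -/
@[fun_prop]
def PolyTime {α β : Type} [Enc α] [Enc β] (f : α → β) : Prop :=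
  ∃ (p : Prog) (q : Polynomial ℕ), ∀ a,
    (∀ u, ∃ n ≤ q.eval (esize a),
      Exec p (top ((enc a).code ++ u)) (top ((enc (f a)).code ++ u)) n) ∧
    esize (f a) ≤ q.eval (esize a)

/-- The first bit of the code is the truth value itself, so one pop decides a branch. -/
instance : Enc Bool where
  enc b := if b then .node .nil .nil else .nil

/-- The representation of a list. -/
def encList {α : Type} [Enc α] : List α → Tree
  | [] => .nil
  | a :: l => .node (enc a) (encList l)

instance {α : Type} [Enc α] : Enc (List α) where
  enc := encList

theorem esize_nil {α : Type} [Enc α] : esize ([] : List α) = 1 := rfl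

theorem esize_cons {α : Type} [Enc α] (a : α) (l : List α) :
    esize (a :: l) = esize a + esize l + 1 := rfl

/-! ### From programs to Turing machines -/

section Machine

variable {A : Type}

/-- The labels of the machine that decides a language with a given program. -/
inductive MainLab (A : Type) (p : Prog) where
  | init
  | read
  | emit (a : A)
  | run (c : Lab p)
  | fin

theorem MainLab.finite [Finite A] (p : Prog) : Finite (MainLab A p) := by
  have := Lab.finite p
  refine Finite.of_surjective (fun x : Option (Option (Option (A ⊕ Lab p))) => match x with
    | none => MainLab.init
    | some none => MainLab.read
    | some (some none) => MainLab.fin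
    | some (some (some (.inl a))) => MainLab.emit a
    | some (some (some (.inr a))) => MainLab.run a) ?_
  rintro (_ | _ | a | c | _)
  exacts [⟨none, rfl⟩, ⟨some none, rfl⟩, ⟨some (some (some (.inl a))), rfl⟩,
    ⟨some (some (some (.inr c))), rfl⟩, ⟨some (some none), rfl⟩]

/-- The statement that pushes all bits of a list on the value stack. -/
def pushAll {Λ : Type} : List Bool → TM2.Stmt (Alph A) Λ (St A) → TM2.Stmt (Alph A) Λ (St A)
  | [], s => s
  | b :: l, s => .push (some .val) (fun _ => b) (pushAll l s)

theorem stepAux_pushAll {Λ : Type} (l : List Bool) (q : TM2.Stmt (Alph A) Λ (St A)) (v : St A)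
    (u : List A) (w : List Bool) :
    TM2.stepAux (pushAll l q) v (contents u (top w)) =
      TM2.stepAux q v (contents u (top (l.reverse ++ w))) := by
  induction l generalizing w with
  | nil => rfl
  | cons b l ih =>
    rw [List.reverse_cons, List.append_assoc, List.singleton_append, ← ih, pushAll]
    exact congrArg (TM2.stepAux (pushAll l q) v) (update_contents u (top w) .val (b :: w))

/-- The machine code that reads the input, runs a program, and outputs the result. -/
def mainStmt [Enc A] (p : Prog) : MainLab A p → TM2.Stmt (Alph A) (MainLab A p) (St A)
  -- The single bit `false` is the code of the empty list.
  | .init => .push (some .val) (fun _ => false) (.goto fun _ => .read)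
  | .read => .pop none (fun v o => (v.1, o))
      (.goto fun v => match v.2 with
        | none => .run (Lab.start p)
        | some a => .emit a)
  -- Putting `true` and the code of `a` in front of the code of a list conses `a` onto it.
  | .emit a => pushAll (enc a).code.reverse
      (.push (some .val) (fun _ => true) (.goto fun _ => .read))
  | .run c => stmts p MainLab.run .fin c
  -- The code of `true` has two more bits to discard, that of `false` has none. The internal state
  -- is reset because a halting configuration must carry the initial one.
  | .fin => .pop (some .val) (fun v o => (decide ((show Option Bool from o) = some true), v.2))
      (.branch (fun v => v.1)
        (.pop (some .val) (fun v _ => v) (.pop (some .val) (fun v _ => v)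
          (.push (some .val) (fun _ => true) (.load (fun _ => (false, none)) .halt))))
        (.push (some .val) (fun _ => false) (.load (fun _ => (false, none)) .halt)))

/-- The machine that decides a language with a given program. -/
noncomputable def machine [Fintype A] [Enc A] (p : Prog) : FinTM2 where
  K := Option Stk
  k₀ := none
  k₁ := some .val
  Γ := Alph A
  Λ := MainLab A p
  main := .init
  ΛFin := @Fintype.ofFinite _ (MainLab.finite p)
  σ := St A
  initialState := (false, none)
  Γk₀Fin := inferInstanceAs (Fintype A)
  m := mainStmt p

/-- Each letter costs a pop and an emission, and one more step notices the end of the input. Since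
letters are consed one by one, the word arrives reversed. -/
theorem steps_read [Enc A] (p : Prog) (w : List A) (v : St A) (l : List A) :
    ∃ v', Steps (TM2.step (mainStmt p)) (2 * w.length + 1)
      ⟨some .read, v, contents w (top (enc l).code)⟩
      ⟨some (.run (Lab.start p)), v', contents [] (top (enc (w.reverse ++ l)).code)⟩ := by
  induction w generalizing v l with
  | nil =>
    refine ⟨(v.1, none), Steps.one ?_⟩
    rw [TM2.step]
    refine congrArg some ?_
    change TM2.Cfg.mk _ _ (Function.update _ _ _) = _
    congr 1
    exact Function.update_eq_self _ _
  | cons a w ih =>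
    obtain ⟨v', h⟩ := ih (v.1, some a) (a :: l)
    refine ⟨v', ?_⟩
    rw [List.reverse_cons, List.append_assoc, List.singleton_append, List.length_cons,
      show 2 * (w.length + 1) + 1 = (1 + 1) + (2 * w.length + 1) by ring]
    refine Steps.trans (Steps.trans (b := ⟨some (.emit a), (v.1, some a),
      contents w (top (enc l).code)⟩) (Steps.one ?_) (Steps.one ?_)) h
    · refine congrArg some ?_
      change TM2.Cfg.mk _ _ (Function.update _ _ _) = _
      congr 1
      funext k
      rcases k with _ | k <;> rfl
    · refine congrArg some ?_
      change TM2.stepAux (pushAll _ _) _ _ = _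
      rw [stepAux_pushAll, List.reverse_reverse]
      exact congrArg (TM2.Cfg.mk _ _) (update_contents w (top _) .val _)

theorem step_fin [Enc A] (p : Prog) (v : St A) (b : Bool) :
    Steps (TM2.step (mainStmt (A := A) p)) 1 ⟨some .fin, v, contents [] (top (enc b).code)⟩
      ⟨none, (false, none), contents [] (top [b])⟩ := by
  refine Steps.one (congrArg some ?_)
  cases b <;>
  · change TM2.Cfg.mk _ _ _ = TM2.Cfg.mk _ _ _
    congr 1
    funext k
    rcases k with _ | _ | _ | _ | _ <;> rfl

theorem esize_list_le [Fintype A] [Enc A] :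
    ∃ c, ∀ l : List A, esize l ≤ c * l.length + 1 := by
  refine ⟨(Finset.univ.sup fun a : A => esize a) + 1, fun l => ?_⟩
  induction l with
  | nil => simp [esize_nil]
  | cons a l ih =>
    have : esize a ≤ Finset.univ.sup fun a : A => esize a :=
      Finset.le_sup (f := fun a : A => esize a) (Finset.mem_univ a)
    rw [esize_cons, List.length_cons]
    linarith

/-- A predicate on words that is computed by a program in polynomial time is computed by a Turing
machine in polynomial time. -/
theorem PolyTime.turing [Fintype A] [Enc A] {f : List A → Bool}
    (hf : PolyTime fun l : List A => f l.reverse) :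
    Nonempty (TM2ComputableInPolyTime (id : List A → List A) Computability.encodeBool f) := by
  obtain ⟨p, q, h⟩ := hf
  obtain ⟨c, hc⟩ := esize_list_le (A := A)
  refine ⟨⟨⟨machine (A := A) p, Equiv.refl A, Equiv.refl Bool⟩,
    -- Initialization and output take one step each, reading takes 2|w| + 1; the program runs on a
    -- tree of size at most c|w| + 1.
    2 * Polynomial.X + 3 + q.comp (Polynomial.C c * Polynomial.X + 1), fun w => ?_⟩⟩
  have key : ∃ n ≤ (2 * Polynomial.X + 3 + q.comp (Polynomial.C c * Polynomial.X + 1)).eval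
      w.length, Steps (TM2.step (mainStmt (A := A) p)) n
        ⟨some .init, (false, none), contents w (top [])⟩
        ⟨none, (false, none), contents [] (top [f w])⟩ := by
    obtain ⟨v₁, h₁⟩ := steps_read p w (false, none) []
    obtain ⟨n, hn, hp⟩ := (h w.reverse).1 []
    obtain ⟨v₂, h₂⟩ := hp.steps [] (mainStmt p) MainLab.run .fin (fun _ => rfl) v₁
    simp only [List.append_nil, List.reverse_reverse] at h₁ h₂
    have h₀ : Steps (TM2.step (mainStmt (A := A) p)) 1
        ⟨some .init, (false, none), contents w (top [])⟩
        ⟨some .read, (false, none), contents w (top (enc ([] : List A)).code)⟩ := by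
      refine Steps.one (congrArg some ?_)
      exact congrArg (TM2.Cfg.mk _ _) (update_contents w (top _) .val _)
    refine ⟨_, ?_, ((h₀.trans h₁).trans h₂).trans (step_fin p v₂ _)⟩
    have := hn.trans (eval_mono q (hc w.reverse))
    simp only [Polynomial.eval_add, Polynomial.eval_mul, Polynomial.eval_ofNat, Polynomial.eval_X,
      Polynomial.eval_comp, Polynomial.eval_C, Polynomial.eval_one]
    rw [List.length_reverse] at this
    omega
  refine ⟨⟨key.choose, ?_⟩, key.choose_spec.1⟩
  have h₁ : initList (machine (A := A) p) (List.map (Equiv.refl A).invFun (id w)) =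
      ⟨some .init, (false, none), contents w (top [])⟩ := by
    refine congrArg (TM2.Cfg.mk _ _) ?_
    funext k
    rcases k with _ | _ | _ | _ | _
    · exact List.map_id w
    all_goals rfl
  have h₂ : haltList (machine (A := A) p)
      (List.map (Equiv.refl Bool).invFun (Computability.encodeBool (f w))) =
      ⟨none, (false, none), contents [] (top [f w])⟩ := by
    refine congrArg (TM2.Cfg.mk _ _) ?_
    funext k
    rcases k with _ | _ | _ | _ | _
    all_goals rfl
  have h₃ := key.choose_spec.2
  exact (congrArg (fun c => (flip bind (machine (A := A) p).step)^[key.choose] (some c)) h₁).trans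
    (Eq.trans h₃ (congrArg some h₂.symm))

end Machine

end StackProg

/-! ### Upper bounds for the running times of programs -/

namespace StackProg

open Turing StateTransition

open Enc (enc)

theorem Tree.length_code (t : Tree) : t.code.length = t.size := by
  induction t with
  | nil => rfl
  | node a b iha ihb => simp [Tree.code, Tree.size, iha, ihb]

/-- `Run p s s' n`: started with the store `s`, the program `p` ends with the store `s'` after at
most `n` steps. -/
def Run (p : Prog) (s s' : Store) (n : ℕ) : Prop := ∃ m ≤ n, Exec p s s' m

namespace Run

variable {p p' : Prog} {s s' s'' : Store} {m n : ℕ} {k : Stk}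

theorem mono (h : Run p s s' m) (hmn : m ≤ n) : Run p s s' n :=
  let ⟨i, hi, he⟩ := h
  ⟨i, hi.trans hmn, he⟩

theorem skip (s : Store) : Run .skip s s 1 := ⟨1, le_rfl, .skip s⟩

theorem push (k : Stk) (b : Bool) (s : Store) : Run (.push k b) s (s.set k (b :: s.get k)) 1 :=
  ⟨1, le_rfl, .push k b s⟩

theorem seq (h : Run p s s' m) (h' : Run p' s' s'' n) : Run (.seq p p') s s'' (m + n) :=
  let ⟨_, hi, he⟩ := h
  let ⟨_, hj, he'⟩ := h'
  ⟨_, add_le_add hi hj, .seq he he'⟩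

theorem branch_true (hk : (s.get k).head? = some true) (h : Run p (s.set k (s.get k).tail) s' n) :
    Run (.branch k p p') s s' (n + 1) :=
  let ⟨_, hi, he⟩ := h
  ⟨_, Nat.succ_le_succ hi, .branch_true hk he⟩

theorem branch_false (hk : ((s.get k).head? == some true) = false)
    (h : Run p' (s.set k (s.get k).tail) s' n) : Run (.branch k p p') s s' (n + 1) :=
  let ⟨_, hi, he⟩ := h
  ⟨_, Nat.succ_le_succ hi, .branch_false (by simpa using hk) he⟩

theorem loop_exit (hk : ((s.get k).head? == some true) = false) :
    Run (.loop k p) s (s.set k (s.get k).tail) 1 :=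
  ⟨1, le_rfl, .loop_exit (by simpa using hk)⟩

theorem loop_step (hk : (s.get k).head? = some true) (h : Run p (s.set k (s.get k).tail) s' m)
    (h' : Run (.loop k p) s' s'' n) : Run (.loop k p) s s'' (m + n + 1) :=
  let ⟨_, hi, he⟩ := h
  let ⟨_, hj, he'⟩ := h'
  ⟨_, Nat.succ_le_succ (add_le_add hi hj), .loop_step hk he he'⟩

end Run

/-! ### Moving trees between stacks -/

/-- A list of bits in which each bit is preceded by a mark `true`. -/
def marked : List Bool → List Bool
  | [] => []
  | b :: l => true :: b :: marked l

theorem marked_append (l l' : List Bool) : marked (l ++ l') = marked l ++ marked l' := by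
  induction l with
  | nil => rfl
  | cons b l ih => simp [marked, ih]

/-- One of the two auxiliary stacks. -/
def side (d : Bool) : Stk := if d then .aux else .tmp

/-- The store with given contents of the value stack, the auxiliary stack `d`, the other auxiliary
stack, and the counter. -/
def sideStore (d : Bool) (v w x c : List Bool) : Store := if d then ⟨v, x, w, c⟩ else ⟨v, w, x, c⟩

/-- The program that pushes a marked bit on a stack. -/
def pushMarked (k : Stk) (b : Bool) : Prog := .seq (.push k b) (.push k true)

/-- The loop that moves as many trees as the counter says to an auxiliary stack, reversed and
marked. -/
def moveLoop (d : Bool) : Prog :=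
  .loop .cnt (.branch .val
    (.seq (pushMarked (side d) true) (.seq (.push .cnt true) (.push .cnt true)))
    (pushMarked (side d) false))

/-- The program that moves the top tree to an auxiliary stack, reversed and marked. -/
def move (d : Bool) : Prog := .seq (.push .cnt true) (moveLoop d)

/-- The counter holds one `true` for each tree still to be read: a node bit replaces one by two, a
leaf bit removes one. The end of a prefix code is thus found without recursion. Stating the claim
with an arbitrary continuation lets the two subtrees be chained. -/
theorem run_moveLoop (d : Bool) (t : Tree) (u w x c : List Bool) (s : Store) (n : ℕ)
    (h : Run (moveLoop d) (sideStore d u (marked t.code.reverse ++ w) x c) s n) :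
    Run (moveLoop d) (sideStore d (t.code ++ u) w x (true :: c)) s (6 * t.size + n) := by
  induction t generalizing u w c n with
  | nil =>
    cases d <;>
    exact Run.mono (Run.loop_step rfl (Run.branch_false rfl ((Run.push _ _ _).seq (Run.push _ _ _)))
      h) (by rw [Tree.size]; omega)
  | node a b iha ihb =>
    have h₁ := iha (b.code ++ u) (true :: true :: w) (true :: c) _
      (ihb u (marked a.code.reverse ++ true :: true :: w) c _
        (by simpa [Tree.code, marked_append, marked] using h))
    rw [← List.append_assoc] at h₁
    cases d <;>
    exact Run.mono (Run.loop_step rfl (Run.branch_true rfl (((Run.push _ _ _).seq (Run.push _ _ _)).seq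
      ((Run.push _ _ _).seq (Run.push _ _ _)))) h₁) (by rw [Tree.size]; omega)

theorem run_move (d : Bool) (t : Tree) (u w x : List Bool) :
    Run (move d) (sideStore d (t.code ++ u) w x [])
      (sideStore d u (marked t.code.reverse ++ w) x []) (6 * t.size + 2) := by
  have h := run_moveLoop d t u w x [] (sideStore d u (marked t.code.reverse ++ w) x []) 1
    (by cases d <;> exact Run.loop_exit rfl)
  cases d <;> exact Run.mono (Run.seq (Run.push _ _ _) h) (by omega)

/-- The program that moves all bits from an auxiliary stack back to the value stack. -/
def unmove (d : Bool) : Prog :=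
  .loop (side d) (.branch (side d) (.push .val true) (.push .val false))

/-- The mark above each bit tells the loop that a bit follows; without marks a stored `false` would
look like the end of the stack. -/
theorem run_unmove (d : Bool) (l u x : List Bool) :
    Run (unmove d) (sideStore d u (marked l) x []) (sideStore d (l.reverse ++ u) [] x [])
      (3 * l.length + 1) := by
  induction l generalizing u with
  | nil => cases d <;> exact Run.loop_exit rfl
  | cons b l ih =>
    have h := ih (b :: u)
    rw [List.reverse_cons, List.append_assoc, List.singleton_append, List.length_cons]
    cases d <;> cases b
    all_goals first
      | exact Run.mono (Run.loop_step rfl (Run.branch_true rfl (Run.push _ _ _)) h) (by omega)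
      | exact Run.mono (Run.loop_step rfl (Run.branch_false rfl (Run.push _ _ _)) h) (by omega)

/-- The program that removes the top tree. -/
def drop : Prog := .seq (move false) (.loop .tmp (.branch .tmp .skip .skip))

theorem run_drop (t : Tree) (u : List Bool) : Run drop (top (t.code ++ u)) (top u)
    (10 * t.size + 3) := by
  have h : ∀ l : List Bool, Run (.loop .tmp (.branch .tmp .skip .skip)) ⟨u, marked l, [], []⟩
      (top u) (3 * l.length + 1) := by
    intro l
    induction l with
    | nil => exact Run.loop_exit rfl
    | cons b l ih =>
      cases b
      · exact Run.mono (Run.loop_step rfl (Run.branch_false rfl (Run.skip _)) ih)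
          (by rw [List.length_cons]; omega)
      · exact Run.mono (Run.loop_step rfl (Run.branch_true rfl (Run.skip _)) ih)
          (by rw [List.length_cons]; omega)
  have h₁ := run_move false t u [] []
  rw [List.append_nil] at h₁
  exact (h₁.seq (h _)).mono (by rw [List.length_reverse, Tree.length_code]; omega)

/-- The program that exchanges the two top trees. -/
def swap : Prog := .seq (.seq (move false) (move true)) (.seq (unmove false) (unmove true))

theorem run_swap (a b : Tree) (u : List Bool) :
    Run swap (top (a.code ++ (b.code ++ u))) (top (b.code ++ (a.code ++ u)))
      (9 * (a.size + b.size) + 6) := by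
  have h₁ := run_move false a (b.code ++ u) [] []
  have h₂ := run_move true b u [] (marked a.code.reverse)
  have h₃ := run_unmove false a.code.reverse u (marked b.code.reverse)
  have h₄ := run_unmove true b.code.reverse (a.code ++ u) []
  rw [List.append_nil] at h₁ h₂
  rw [List.reverse_reverse, List.length_reverse, Tree.length_code] at h₃ h₄
  exact Run.mono ((h₁.seq h₂).seq (h₃.seq h₄)) (by omega)

/-- The program that brings the third tree between the first and the second one. -/
def rotate : Prog :=
  .seq (.seq (move false) (.seq (move true) (move false))) (.seq (unmove true) (unmove false))

/-- The first and third trees share one auxiliary stack, the third on top. Emptying the stack of the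
second tree first and then the shared one yields the new order. -/
theorem run_rotate (a b c : Tree) (u : List Bool) :
    Run rotate (top (a.code ++ (b.code ++ (c.code ++ u))))
      (top (a.code ++ (c.code ++ (b.code ++ u)))) (9 * (a.size + b.size + c.size) + 8) := by
  have h₁ := run_move false a (b.code ++ (c.code ++ u)) [] []
  have h₂ := run_move true b (c.code ++ u) [] (marked a.code.reverse)
  have h₃ := run_move false c u (marked a.code.reverse) (marked b.code.reverse)
  have h₄ := run_unmove true b.code.reverse u (marked (c.code.reverse ++ a.code.reverse))
  have h₅ := run_unmove false (c.code.reverse ++ a.code.reverse) (b.code ++ u) []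
  rw [List.append_nil] at h₁ h₂
  rw [← marked_append] at h₃
  rw [List.reverse_reverse, List.length_reverse, Tree.length_code] at h₄
  rw [List.reverse_append, List.reverse_reverse, List.reverse_reverse, List.length_append,
    List.length_reverse, List.length_reverse, Tree.length_code, Tree.length_code,
    List.append_assoc] at h₅
  exact ((h₁.seq (h₂.seq h₃)).seq (h₄.seq h₅)).mono (by omega)

/-- The program that duplicates the top tree. -/
def dup : Prog :=
  .seq (.seq (move false) (.loop .tmp (.branch .tmp (.seq (.push .val true) (pushMarked .aux true))
    (.seq (.push .val false) (pushMarked .aux false)))))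
    (.seq (.loop .aux (.branch .aux (pushMarked .tmp true) (pushMarked .tmp false)))
      (unmove false))

/-- While the bits return to the value stack, a copy collects on `aux`. It then passes through
`tmp`, which corrects its orientation. -/
theorem run_dup (t : Tree) (u : List Bool) :
    Run dup (top (t.code ++ u)) (top (t.code ++ (t.code ++ u))) (18 * t.size + 5) := by
  have h₁ := run_move false t u [] []
  have h₂ : ∀ l u x : List Bool, Run (.loop .tmp (.branch .tmp
      (.seq (.push .val true) (pushMarked .aux true))
      (.seq (.push .val false) (pushMarked .aux false)))) ⟨u, marked l, marked x, []⟩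
      ⟨l.reverse ++ u, [], marked (l.reverse ++ x), []⟩ (5 * l.length + 1) := by
    intro l
    induction l with
    | nil => exact fun u x => Run.loop_exit rfl
    | cons b l ih =>
      intro u x
      rw [List.reverse_cons, List.append_assoc, List.singleton_append, List.append_assoc,
        List.singleton_append, List.length_cons]
      have h := ih (b :: u) (b :: x)
      cases b
      · exact Run.mono (Run.loop_step rfl (Run.branch_false rfl ((Run.push _ _ _).seq
          ((Run.push _ _ _).seq (Run.push _ _ _)))) h) (by omega)
      · exact Run.mono (Run.loop_step rfl (Run.branch_true rfl ((Run.push _ _ _).seq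
          ((Run.push _ _ _).seq (Run.push _ _ _)))) h) (by omega)
  have h₃ : ∀ u l x : List Bool, Run (.loop .aux (.branch .aux (pushMarked .tmp true)
      (pushMarked .tmp false))) ⟨u, marked x, marked l, []⟩
      ⟨u, marked (l.reverse ++ x), [], []⟩ (4 * l.length + 1) := by
    intro u l
    induction l with
    | nil => exact fun x => Run.loop_exit rfl
    | cons b l ih =>
      intro x
      rw [List.reverse_cons, List.append_assoc, List.singleton_append, List.length_cons]
      have h := ih (b :: x)
      cases b
      · exact Run.mono (Run.loop_step rfl (Run.branch_false rfl
          ((Run.push _ _ _).seq (Run.push _ _ _))) h) (by omega)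
      · exact Run.mono (Run.loop_step rfl (Run.branch_true rfl
          ((Run.push _ _ _).seq (Run.push _ _ _))) h) (by omega)
  have h₂' := h₂ t.code.reverse u []
  have h₃' := h₃ (t.code ++ u) t.code []
  have h₄ := run_unmove false t.code.reverse (t.code ++ u) []
  rw [List.append_nil] at h₁ h₃'
  rw [List.append_nil, List.reverse_reverse] at h₂'
  rw [List.reverse_reverse] at h₄
  refine ((h₁.seq h₂').seq (h₃'.seq h₄)).mono ?_
  rw [List.length_reverse, Tree.length_code]
  omega

/-- The program that pushes all bits of a list on the value stack. -/
def pushBits : List Bool → Prog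
  | [] => .skip
  | b :: l => .seq (.push .val b) (pushBits l)

theorem run_pushBits (l u : List Bool) :
    Run (pushBits l) (top u) (top (l.reverse ++ u)) (l.length + 1) := by
  induction l generalizing u with
  | nil => exact Run.skip _
  | cons b l ih =>
    rw [List.reverse_cons, List.append_assoc, List.singleton_append]
    exact ((Run.push .val b (top u)).seq (ih (b :: u))).mono (by rw [List.length_cons]; omega)

/-- The program that pushes a tree on the value stack. -/
def pushTree (t : Tree) : Prog := pushBits t.code.reverse

theorem run_pushTree (t : Tree) (u : List Bool) :
    Run (pushTree t) (top u) (top (t.code ++ u)) (t.size + 1) := by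
  have := run_pushBits t.code.reverse u
  rwa [List.reverse_reverse, List.length_reverse, Tree.length_code] at this

end StackProg

/-! ### Closure properties of polynomial-time functions -/

namespace StackProg

open Turing StateTransition

open Enc (enc)

variable {α β γ δ σ : Type} [Enc α] [Enc β] [Enc γ] [Enc δ] [Enc σ]

instance : Enc (α × β) where
  enc x := .node (enc x.1) (enc x.2)

theorem esize_prod (x : α × β) : esize x = esize x.1 + esize x.2 + 1 := rfl

theorem esize_pos (a : α) : 0 < esize a := Tree.size_pos _

theorem esize_bool_le (b : Bool) : esize b ≤ 3 := by cases b <;> decide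

namespace PolyTime

/-- Equal codes need no work, so a change of type, such as reading a pair as a cons cell, is free.
-/
theorem of_enc_eq {f : α → β} (h : ∀ a, enc (f a) = enc a) : PolyTime f := by
  refine ⟨.skip, Polynomial.X, fun a => ⟨fun u => ?_, ?_⟩⟩
  · rw [Polynomial.eval_X, h]
    exact (Run.skip _).mono (esize_pos a)
  · rw [Polynomial.eval_X, esize, esize, h]

@[fun_prop]
theorem id : PolyTime (fun a : α => a) := of_enc_eq fun _ => rfl

@[fun_prop]
theorem comp {g : β → γ} {f : α → β} (hg : PolyTime g) (hf : PolyTime f) :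
    PolyTime fun a => g (f a) := by
  obtain ⟨p, q, h⟩ := hf
  obtain ⟨p', q', h'⟩ := hg
  refine ⟨.seq p p', q + q'.comp q, fun a => ⟨fun u => ?_, ?_⟩⟩
  · refine Run.mono (Run.seq ((h a).1 u) ((h' (f a)).1 u)) ?_
    rw [Polynomial.eval_add, Polynomial.eval_comp]
    exact Nat.add_le_add_left (eval_mono q' (h a).2) _
  · rw [Polynomial.eval_add, Polynomial.eval_comp]
    exact ((h' (f a)).2.trans (eval_mono q' (h a).2)).trans (Nat.le_add_left _ _)

@[fun_prop]
theorem const (b : β) : PolyTime fun _ : α => b := by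
  refine ⟨.seq drop (pushTree (enc b)), 10 * Polynomial.X + 4 + Polynomial.C (esize b),
    fun a => ⟨fun u => ?_, ?_⟩⟩
  · refine Run.mono (Run.seq (run_drop (enc a) u) (run_pushTree (enc b) u)) ?_
    simp [esize]
    omega
  · simp

/-- The branch only removes the leading node bit of the pair; its `skip` side is never reached. -/
theorem fst_aux : PolyTime fun x : α × β => x.1 := by
  refine ⟨.branch .val (.seq swap drop) .skip, 20 * Polynomial.X + 20, fun x => ⟨fun u => ?_, ?_⟩⟩
  · have h₁ := run_swap (enc x.1) (enc x.2) u
    have h₂ := run_drop (enc x.2) ((enc x.1).code ++ u)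
    rw [← List.append_assoc] at h₁
    refine Run.mono (Run.branch_true rfl (Run.seq h₁ h₂)) ?_
    simp [esize_prod]
    simp [esize]
    omega
  · simp [esize_prod]
    omega

theorem snd_aux : PolyTime fun x : α × β => x.2 := by
  refine ⟨.branch .val drop .skip, 20 * Polynomial.X + 20, fun x => ⟨fun u => ?_, ?_⟩⟩
  · have h₂ := run_drop (enc x.1) ((enc x.2).code ++ u)
    rw [← List.append_assoc] at h₂
    refine Run.mono (Run.branch_true rfl h₂) ?_
    simp [esize_prod]
    simp [esize]
    omega
  · simp [esize_prod]
    omega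

@[fun_prop]
theorem fst {f : α → β × γ} (hf : PolyTime f) : PolyTime fun a => (f a).1 := fst_aux.comp hf

@[fun_prop]
theorem snd {f : α → β × γ} (hf : PolyTime f) : PolyTime fun a => (f a).2 := snd_aux.comp hf

@[fun_prop]
theorem pair {f : α → β} {g : α → γ} (hf : PolyTime f) (hg : PolyTime g) :
    PolyTime fun a => (f a, g a) := by
  obtain ⟨p, q, h⟩ := hf
  obtain ⟨p', q', h'⟩ := hg
  -- The second component is computed first because it must lie below the first; the final `true` is
  -- the node bit of the pair.
  refine ⟨.seq (.seq dup p') (.seq swap (.seq p (.push .val true))),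
    q + 10 * q' + 30 * Polynomial.X + 20, fun a => ⟨fun u => ?_, ?_⟩⟩
  · have h₁ := run_dup (enc a) u
    have h₂ := (h' a).1 ((enc a).code ++ u)
    have h₃ := run_swap (enc (g a)) (enc a) u
    have h₄ := (h a).1 ((enc (g a)).code ++ u)
    have h₅ := Run.push .val true (top ((enc (f a)).code ++ ((enc (g a)).code ++ u)))
    have h₆ := Run.seq (Run.seq h₁ h₂) (Run.seq h₃ (Run.seq h₄ h₅))
    have e : (Store.set (top ((enc (f a)).code ++ ((enc (g a)).code ++ u))) .val
        (true :: Store.get (top ((enc (f a)).code ++ ((enc (g a)).code ++ u))) .val)) =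
        top ((enc (f a, g a)).code ++ u) := by
      rw [← List.append_assoc]
      rfl
    rw [e] at h₆
    refine h₆.mono ?_
    have := (h' a).2
    simp [esize] at *
    omega
  · have := (h' a).2
    have := (h a).2
    have := esize_pos a
    simp [esize_prod]
    omega

@[fun_prop]
theorem ite {c : α → Bool} {f g : α → β} (hc : PolyTime c) (hf : PolyTime f) (hg : PolyTime g) :
    PolyTime fun a => if c a = true then f a else g a := by
  obtain ⟨p, q, h⟩ := hf
  obtain ⟨p', q', h'⟩ := hg
  obtain ⟨pc, qc, hc⟩ := hc
  -- After its first bit is popped, the code of `true` leaves two leaves to drop.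
  refine ⟨.seq dup (.seq pc (.branch .val (.seq drop (.seq drop p)) p')),
    q + q' + qc + 30 * Polynomial.X + 50, fun a => ⟨fun u => ?_, ?_⟩⟩
  · have h₁ := run_dup (enc a) u
    have h₂ := (hc a).1 ((enc a).code ++ u)
    by_cases hca : c a = true
    · simp only [hca, if_true]
      rw [hca] at h₂
      have h₃ := run_drop .nil (false :: ((enc a).code ++ u))
      have h₄ := run_drop .nil ((enc a).code ++ u)
      refine Run.mono (Run.seq h₁ (Run.seq h₂ (Run.branch_true rfl
        (Run.seq h₃ (Run.seq h₄ ((h a).1 u)))))) ?_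
      simp [esize, Tree.size]
      omega
    · rw [Bool.not_eq_true] at hca
      simp only [hca, Bool.false_eq_true, if_false]
      rw [hca] at h₂
      refine Run.mono (Run.seq h₁ (Run.seq h₂ (Run.branch_false rfl ((h' a).1 u)))) ?_
      simp [esize]
      omega
  · have := (h' a).2
    have := (h a).2
    simp
    split <;> omega

/-! ### Lists -/

@[fun_prop]
theorem cons {f : α → β} {l : α → List β} (hf : PolyTime f) (hl : PolyTime l) :
    PolyTime fun a => f a :: l a :=
  (of_enc_eq (f := fun x : β × List β => x.1 :: x.2) fun _ => rfl).comp (hf.pair hl)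

@[fun_prop]
theorem tail {l : α → List β} (hl : PolyTime l) : PolyTime fun a => (l a).tail := by
  refine comp (g := List.tail) ?_ hl
  refine ⟨.branch .val drop (.push .val false), 20 * Polynomial.X + 20,
    fun x => ⟨fun u => ?_, ?_⟩⟩
  · rcases x with _ | ⟨b, l⟩
    · refine Run.mono (Run.branch_false rfl (Run.push _ _ _)) ?_
      simp
    · have h₂ := run_drop (enc b) ((enc l).code ++ u)
      rw [← List.append_assoc] at h₂
      refine Run.mono (Run.branch_true rfl h₂) ?_
      simp [esize_cons]
      simp [esize]
      omega
  · rcases x with _ | ⟨b, l⟩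
    · simp
      omega
    · simp [esize_cons]
      omega

@[fun_prop]
theorem isEmpty {l : α → List β} (hl : PolyTime l) : PolyTime fun a => (l a).isEmpty := by
  refine comp (g := List.isEmpty) ?_ hl
  refine ⟨.branch .val (.seq drop (.seq drop (.push .val false))) (pushTree (enc true)),
    20 * Polynomial.X + 20, fun x => ⟨fun u => ?_, ?_⟩⟩
  · rcases x with _ | ⟨b, l⟩
    · refine Run.mono (Run.branch_false rfl (run_pushTree (enc true) u)) ?_
      simp [enc, Tree.size]
    · have h₁ := run_drop (enc b) ((enc l).code ++ u)
      have h₂ := run_drop (enc l) u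
      rw [← List.append_assoc] at h₁
      refine Run.mono (Run.branch_true rfl (Run.seq h₁ (Run.seq h₂ (Run.push _ _ _)))) ?_
      simp [esize_cons]
      simp [esize]
      omega
  · have := esize_bool_le x.isEmpty
    simp
    omega

@[fun_prop]
theorem headD {l : α → List β} {f : α → β} (hl : PolyTime l) (hf : PolyTime f) :
    PolyTime fun a => (l a).headD (f a) := by
  refine comp (g := fun x : List β × β => x.1.headD x.2) ?_ (hl.pair hf)
  refine ⟨.branch .val (.branch .val (.seq (.seq swap drop) (.seq swap drop)) .skip) .skip,
    50 * Polynomial.X + 50, fun x => ⟨fun u => ?_, ?_⟩⟩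
  · rcases x with ⟨_ | ⟨b, l⟩, d⟩
    · refine Run.mono (Run.branch_true rfl (Run.branch_false rfl (Run.skip _))) ?_
      simp
    · have h₁ := run_swap (enc b) (enc l) ((enc d).code ++ u)
      have h₂ := run_drop (enc l) ((enc b).code ++ ((enc d).code ++ u))
      have h₃ := run_swap (enc b) (enc d) u
      have h₄ := run_drop (enc d) ((enc b).code ++ u)
      rw [← List.append_assoc, ← List.append_assoc] at h₁
      refine Run.mono (Run.branch_true rfl (Run.branch_true rfl (Run.seq (Run.seq h₁ h₂)
        (Run.seq h₃ h₄)))) ?_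
      simp [esize_prod, esize_cons]
      simp [esize]
      omega
  · rcases x with ⟨_ | ⟨b, l⟩, d⟩
    · simp [esize_prod]
      omega
    · simp [esize_prod, esize_cons]
      omega

/-- The program that folds the list on top of the value stack, with the tree below it as the
initial state, and a program for the steps. -/
def foldProg (p : Prog) : Prog :=
  .loop .val (.seq rotate (.seq (.push .val true) (.seq p swap)))

/-- The loop test pops the cons bit. `rotate` moves the state directly below the head, a pushed
`true` makes the two a pair for `p`, and `swap` brings the rest of the list back on top. The size of
the list bounds the number of rounds, and the bound on all intermediate states bounds each round. -/
theorem run_foldProg {g : β × σ → σ} {p : Prog} {q : Polynomial ℕ}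
    (hp : ∀ x, (∀ u, Run p (top ((enc x).code ++ u)) (top ((enc (g x)).code ++ u))
      (q.eval (esize x)))) (N : ℕ) (l : List β) (s : σ) (hl : esize l ≤ N)
    (hN : ∀ l', l' <+: l → esize (l'.foldl (fun s x => g (x, s)) s) ≤ N) (u : List Bool) :
    Run (foldProg p) (top ((enc l).code ++ ((enc s).code ++ u)))
      (top ((enc (l.foldl (fun s x => g (x, s)) s)).code ++ u))
      (esize l * (40 * N + q.eval (2 * N) + 30) + 1) := by
  induction l generalizing s with
  | nil => exact Run.mono (Run.loop_exit rfl) (by omega)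
  | cons b l ih =>
    rw [esize_cons] at hl
    have hs : esize s ≤ N := hN [] List.nil_prefix
    have hs' : esize (g (b, s)) ≤ N := hN [b] ⟨l, rfl⟩
    have ih' := ih (g (b, s)) (by omega) fun l' hl' =>
      hN (b :: l') (List.cons_prefix_cons.2 ⟨rfl, hl'⟩)
    have h₁ := run_rotate (enc b) (enc l) (enc s) u
    have h₂ := Run.push .val true (top ((enc b).code ++ ((enc s).code ++ ((enc l).code ++ u))))
    have h₃ := hp (b, s) ((enc l).code ++ u)
    have h₄ := run_swap (enc (g (b, s))) (enc l) u
    have e : (Store.set (top ((enc b).code ++ ((enc s).code ++ ((enc l).code ++ u)))) .val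
        (true :: Store.get (top ((enc b).code ++ ((enc s).code ++ ((enc l).code ++ u)))) .val)) =
        top ((enc (b, s)).code ++ ((enc l).code ++ u)) := by
      rw [← List.append_assoc (enc b).code]
      rfl
    rw [e] at h₂
    rw [← List.append_assoc (enc b).code] at h₁
    refine Run.mono (Run.loop_step rfl (Run.seq h₁ (Run.seq h₂ (Run.seq h₃ h₄))) ih') ?_
    have hq : q.eval (esize (b, s)) ≤ q.eval (2 * N) := eval_mono q (by
      have := esize_pos l
      change esize b + esize s + 1 ≤ _
      omega)
    rw [esize_cons]
    have h₅ : 1 * (40 * N + q.eval (2 * N) + 30) ≤ esize b * (40 * N + q.eval (2 * N) + 30) :=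
      Nat.mul_le_mul_right _ (esize_pos b)
    rw [add_mul, add_mul]
    change _ + (esize l * _ + 1) + 1 ≤ _
    unfold esize at *
    omega

theorem foldl_aux {g : β × σ → σ} (hg : PolyTime g) {l : α → List β} {s : α → σ}
    (hl : PolyTime l) (hs : PolyTime s) (B : Polynomial ℕ)
    (hB : ∀ a l', l' <+: l a → esize (l'.foldl (fun s x => g (x, s)) (s a)) ≤ B.eval (esize a)) :
    PolyTime fun a => (l a).foldl (fun s x => g (x, s)) (s a) := by
  obtain ⟨pi, qi, hi⟩ := hl.pair hs
  obtain ⟨p, q, h⟩ := hg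
  refine ⟨.seq pi (.branch .val (foldProg p) .skip),
    qi + (qi * (40 * (qi + B) + q.comp (2 * (qi + B)) + 30) + 2) + B, fun a => ⟨fun u => ?_, ?_⟩⟩
  · have hsz : esize (l a) ≤ qi.eval (esize a) := by
      have := (hi a).2
      rw [esize_prod] at this
      dsimp only at this
      omega
    have h₁ := run_foldProg (fun x => (h x).1) ((qi + B).eval (esize a)) (l a) (s a)
      (by rw [Polynomial.eval_add]; omega)
      (fun l' hl' => by
        have := hB a l' hl'
        rw [Polynomial.eval_add]
        omega) u
    rw [← List.append_assoc] at h₁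
    refine Run.mono (Run.seq ((hi a).1 u) (Run.branch_true rfl h₁)) ?_
    have := Nat.mul_le_mul_right (40 * (qi + B).eval (esize a) +
      q.eval (2 * (qi + B).eval (esize a)) + 30) hsz
    simp only [Polynomial.eval_add, Polynomial.eval_mul, Polynomial.eval_comp,
      Polynomial.eval_ofNat] at *
    omega
  · have := hB a (l a) List.prefix_rfl
    rw [Polynomial.eval_add]
    exact this.trans (Nat.le_add_left _ _)

theorem exists_bound {f : α → β} (hf : PolyTime f) :
    ∃ q : Polynomial ℕ, ∀ a, esize (f a) ≤ q.eval (esize a) :=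
  let ⟨_, q, h⟩ := hf
  ⟨q, fun a => (h a).2⟩

/-- Folding along a list takes polynomial time if the sizes of all intermediate results are
polynomially bounded. -/
theorem foldl {l : α → List β} {s : α → σ} {g : α → σ → β → σ} (hl : PolyTime l)
    (hs : PolyTime s) (hg : PolyTime fun x : α × σ × β => g x.1 x.2.1 x.2.2) (B : Polynomial ℕ)
    (hB : ∀ a l', l' <+: l a → esize (l'.foldl (g a) (s a)) ≤ B.eval (esize a)) :
    PolyTime fun a => (l a).foldl (g a) (s a) := by
  -- The step program sees only an element and the state, so the argument `a` is carried along
  -- inside the state.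
  have e : ∀ (a : α) (l : List β) (s : σ),
      l.foldl (fun (t : α × σ) x => (t.1, g t.1 t.2 x)) (a, s) = (a, l.foldl (g a) s) := by
    intro a l
    induction l with
    | nil => exact fun s => rfl
    | cons b l ih => exact fun s => ih _
  have h := foldl_aux (α := α) (g := fun x : β × α × σ => (x.2.1, g x.2.1 x.2.2 x.1))
    (l := l) (s := fun a => (a, s a))
    (by fun_prop) hl (id.pair hs)
    (Polynomial.X + B + 1) (by
      intro a l' hl'
      rw [e, esize_prod]
      have := hB a l' hl'
      simp
      omega)
  simp only [e] at h
  exact h.snd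

end PolyTime

end StackProg

namespace StackProg

open Enc (enc)

variable {α β γ δ σ : Type} [Enc α] [Enc β] [Enc γ] [Enc δ] [Enc σ]

/-! ### Sizes -/

theorem esize_le_of_mem {x : β} {l : List β} (h : x ∈ l) : esize x + 1 ≤ esize l := by
  induction l with
  | nil => simp at h
  | cons b l ih =>
    rw [esize_cons]
    rcases List.mem_cons.1 h with rfl | h
    · have := esize_pos l
      omega
    · have := ih h
      omega

theorem length_le_esize (l : List β) : 2 * l.length + 1 ≤ esize l := by
  induction l with
  | nil => simp [esize_nil]
  | cons b l ih =>
    rw [esize_cons, List.length_cons]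
    have := esize_pos b
    omega

theorem esize_append (l l' : List β) : esize (l ++ l') + 1 = esize l + esize l' := by
  induction l with
  | nil => simp [esize_nil]; omega
  | cons b l ih =>
    rw [List.cons_append, esize_cons, esize_cons]
    omega

theorem esize_reverse (l : List β) : esize l.reverse = esize l := by
  induction l with
  | nil => rfl
  | cons b l ih =>
    have := esize_append l.reverse [b]
    rw [List.reverse_cons, esize_cons]
    rw [esize_cons, esize_nil] at this
    omega

theorem esize_tail_le (l : List β) : esize l.tail ≤ esize l := by
  cases l with
  | nil => exact le_rfl
  | cons b l =>
    rw [esize_cons, List.tail_cons]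
    omega

theorem esize_le_of_forall {l : List β} {n : ℕ} (h : ∀ x ∈ l, esize x ≤ n) :
    esize l ≤ l.length * (n + 1) + 1 := by
  induction l with
  | nil => simp [esize_nil]
  | cons b l ih =>
    have h₁ := h b (by simp)
    have h₂ := ih fun x hx => h x (by simp [hx])
    rw [esize_cons, List.length_cons, add_mul]
    omega

theorem esize_bits_le (l : List Bool) : esize l ≤ 4 * l.length + 1 := by
  have := esize_le_of_forall (l := l) (n := 3) fun x _ => esize_bool_le x
  omega

/-! ### Standard list functions as folds -/

namespace PolyTime

/-- Folding along a list takes polynomial time if each step adds at most a polynomially bounded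
amount to the size of the state. -/
theorem foldl_growth {l : α → List β} {s : α → σ} {g : α → σ → β → σ} (hl : PolyTime l)
    (hs : PolyTime s) (hg : PolyTime fun x : α × σ × β => g x.1 x.2.1 x.2.2)
    (h : ∃ q : Polynomial ℕ, ∀ a t, ∀ x ∈ l a, esize (g a t x) ≤ esize t + q.eval (esize a)) :
    PolyTime fun a => (l a).foldl (g a) (s a) := by
  obtain ⟨q, hq⟩ := h
  obtain ⟨ql, hql⟩ := hl.exists_bound
  obtain ⟨qs, hqs⟩ := hs.exists_bound
  refine foldl hl hs hg (qs + ql * q) fun a l' hl' => ?_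
  have key : ∀ (l' : List β) (t : σ), (∀ x ∈ l', x ∈ l a) →
      esize (l'.foldl (g a) t) ≤ esize t + l'.length * q.eval (esize a) := by
    intro l'
    induction l' with
    | nil => simp
    | cons b l' ih =>
      intro t hb
      have h₁ := ih (g a t b) fun x hx => hb x (by simp [hx])
      have h₂ := hq a t b (hb b (by simp))
      rw [List.foldl_cons, List.length_cons, add_mul]
      omega
  have h₁ := key l' (s a) fun x hx => hl'.subset hx
  have h₂ := hqs a
  have h₃ : l'.length ≤ ql.eval (esize a) := by
    have := hl'.length_le
    have := length_le_esize (l a)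
    have := hql a
    omega
  have h₄ := Nat.mul_le_mul_right (q.eval (esize a)) h₃
  simp only [Polynomial.eval_add, Polynomial.eval_mul]
  omega

theorem congr_enc {f : α → β} {g : α → γ} (hg : PolyTime g) (h : ∀ a, enc (f a) = enc (g a)) :
    PolyTime f := by
  obtain ⟨p, q, hp⟩ := hg
  refine ⟨p, q, fun a => ?_⟩
  have e : esize (f a) = esize (g a) := congrArg Tree.size (h a)
  rw [e, h]
  exact hp a

theorem exists_bound₂ {l : α → List β} {g : α → β → γ} (hl : PolyTime l)
    (hg : PolyTime fun x : α × β => g x.1 x.2) :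
    ∃ q : Polynomial ℕ, ∀ a, ∀ x ∈ l a, esize (g a x) ≤ q.eval (esize a) := by
  obtain ⟨q, hq⟩ := hg.exists_bound
  obtain ⟨ql, hql⟩ := hl.exists_bound
  refine ⟨q.comp (Polynomial.X + ql), fun a x hx => ?_⟩
  rw [Polynomial.eval_comp]
  refine (hq (a, x)).trans (eval_mono q ?_)
  have := hql a
  have := esize_le_of_mem hx
  simp only [esize_prod, Polynomial.eval_add, Polynomial.eval_X]
  omega

/-- A fold builds its result by prepending, which reverses it. This common form yields reversal,
concatenation and mapping. -/
theorem reverseMap {l : α → List β} {g : α → β → γ} {s : α → List γ} (hl : PolyTime l)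
    (hg : PolyTime fun x : α × β => g x.1 x.2) (hs : PolyTime s) :
    PolyTime fun a => (l a).foldl (fun acc x => g a x :: acc) (s a) := by
  obtain ⟨q, hq⟩ := exists_bound₂ hl hg
  refine foldl_growth hl hs ?_ ⟨q + 1, fun a t x hx => ?_⟩
  · exact cons (hg.comp (f := fun x : α × List γ × β => (x.1, x.2.2)) (by fun_prop)) (by fun_prop)
  · have := hq a x hx
    rw [esize_cons, Polynomial.eval_add, Polynomial.eval_one]
    omega

@[fun_prop]
theorem reverse {l : α → List β} (hl : PolyTime l) : PolyTime fun a => (l a).reverse := by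
  have := reverseMap (g := fun _ x => x) hl (by fun_prop) (const [])
  simpa using this

@[fun_prop]
theorem append {l l' : α → List β} (hl : PolyTime l) (hl' : PolyTime l') :
    PolyTime fun a => l a ++ l' a := by
  have := reverseMap (g := fun _ x => x) hl.reverse (by fun_prop) hl'
  simpa using this

@[fun_prop]
theorem map {l : α → List β} {g : α → β → γ} (hl : PolyTime l)
    (hg : PolyTime fun x : α × β => g x.1 x.2) : PolyTime fun a => (l a).map (g a) := by
  have := reverseMap hl.reverse hg (const [])
  simpa using this

@[fun_prop]
theorem flatMap {l : α → List β} {g : α → β → List γ} (hl : PolyTime l)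
    (hg : PolyTime fun x : α × β => g x.1 x.2) : PolyTime fun a => (l a).flatMap (g a) := by
  obtain ⟨q, hq⟩ := exists_bound₂ hl hg
  have h := foldl_growth (s := fun _ => []) (g := fun a acc x => g a x ++ acc) hl.reverse
    (const [])
    (append (hg.comp (f := fun x : α × List γ × β => (x.1, x.2.2)) (by fun_prop)) (by fun_prop))
    ⟨q, fun a t x hx => by
      have := hq a x (List.mem_reverse.1 hx)
      have := esize_append (g a x) t
      omega⟩
  convert h using 2 with a
  rw [List.foldl_reverse]
  induction l a with
  | nil => rfl
  | cons b l ih => simp [ih]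

@[fun_prop]
theorem and {f g : α → Bool} (hf : PolyTime f) (hg : PolyTime g) :
    PolyTime fun a => f a && g a := by
  convert hf.ite hg (const false) using 2 with a
  cases f a <;> rfl

@[fun_prop]
theorem or {f g : α → Bool} (hf : PolyTime f) (hg : PolyTime g) :
    PolyTime fun a => f a || g a := by
  convert hf.ite (const true) hg using 2 with a
  cases f a <;> rfl

@[fun_prop]
theorem not {f : α → Bool} (hf : PolyTime f) : PolyTime fun a => !f a := by
  convert hf.ite (const false) (const true) using 2 with a
  cases f a <;> rfl

@[fun_prop]
theorem filter {l : α → List β} {c : α → β → Bool} (hl : PolyTime l)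
    (hc : PolyTime fun x : α × β => c x.1 x.2) : PolyTime fun a => (l a).filter (c a) := by
  have h : PolyTime fun a => (l a).flatMap fun x => if c a x = true then [x] else [] := by
    fun_prop
  convert h using 2 with a
  induction l a with
  | nil => rfl
  | cons b l ih => cases hb : c a b <;> simp [hb, ih]

@[fun_prop]
theorem any {l : α → List β} {c : α → β → Bool} (hl : PolyTime l)
    (hc : PolyTime fun x : α × β => c x.1 x.2) : PolyTime fun a => (l a).any (c a) := by
  have h : PolyTime fun a => !((l a).filter (c a)).isEmpty := by fun_prop
  convert h using 2 with a
  induction l a with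
  | nil => rfl
  | cons b l ih => cases hb : c a b <;> simp [hb, ih]

@[fun_prop]
theorem all {l : α → List β} {c : α → β → Bool} (hl : PolyTime l)
    (hc : PolyTime fun x : α × β => c x.1 x.2) : PolyTime fun a => (l a).all (c a) := by
  have h : PolyTime fun a => !(l a).any fun x => !c a x := by fun_prop
  convert h using 2 with a
  exact List.all_eq_not_any_not

/-- A list with at most one element serves as an optional head in `zip`, where no default value for
`headD` is at hand. -/
theorem take_one {l : α → List β} (hl : PolyTime l) : PolyTime fun a => (l a).take 1 := by
  obtain ⟨q, hq⟩ := hl.exists_bound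
  have h := foldl_growth (s := fun _ => ([] : List β))
    (g := fun _ s x => if s.isEmpty = true then [x] else s) hl (by fun_prop) (by fun_prop)
    ⟨q, fun a t x hx => by
      have := hq a
      have := esize_le_of_mem hx
      cases t with
      | nil =>
        simp [esize_cons, esize_nil]
        omega
      | cons b t =>
        simp⟩
  convert h using 2 with a
  rcases l a with _ | ⟨b, l⟩
  · rfl
  · have : ∀ l : List β, l.foldl (fun s x => if s.isEmpty = true then [x] else s) [b] = [b] := by
      intro l
      induction l with
      | nil => rfl
      | cons c l ih => exact ih
    exact (this l).symm

@[fun_prop]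
theorem zip {l : α → List β} {l' : α → List γ} (hl : PolyTime l) (hl' : PolyTime l') :
    PolyTime fun a => (l a).zip (l' a) := by
  obtain ⟨q, hq⟩ := hl.exists_bound
  have h := foldl_growth (s := fun a => (l' a, ([] : List (β × γ))))
    (g := fun _ s x => (s.1.tail, (s.1.take 1).map (fun y => (x, y)) ++ s.2)) hl (by fun_prop)
    (by
      have : PolyTime fun x : α × (List γ × List (β × γ)) × β => x.2.1.1.take 1 :=
        take_one (by fun_prop)
      fun_prop)
    ⟨q + 1, fun a t x hx => by
      have := hq a
      have := esize_le_of_mem hx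
      rcases t with ⟨_ | ⟨c, t⟩, s⟩
      · simp [esize_prod]
      · simp [esize_prod, esize_cons]
        omega⟩
  convert h.snd.reverse using 2 with a
  have key : ∀ (l : List β) (l' : List γ) (s : List (β × γ)),
      (l.foldl (fun (s : List γ × List (β × γ)) x =>
        (s.1.tail, (s.1.take 1).map (fun y => (x, y)) ++ s.2)) (l', s)).2 =
        (l.zip l').reverse ++ s := by
    intro l
    induction l with
    | nil => exact fun l' s => rfl
    | cons b l ih =>
      rintro (_ | ⟨c, l'⟩) s
      · rw [List.foldl_cons, ih]
        simp
      · rw [List.foldl_cons, ih]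
        simp
  rw [key]
  simp

end PolyTime

/-! ### Unary numbers and equality -/

/-- Natural numbers are represented in unary. -/
instance : Enc ℕ where
  enc n := encList (List.replicate n false)

theorem esize_nat (n : ℕ) : esize n = 2 * n + 1 := by
  change esize (List.replicate n false) = _
  induction n with
  | zero => rfl
  | succ n ih =>
    rw [List.replicate_succ, esize_cons, ih]
    change 1 + _ + 1 = _
    ring

/-- Equality as a boolean function. -/
def eqb {τ : Type*} [DecidableEq τ] (x y : τ) : Bool := decide (x = y)

@[simp]
theorem eqb_iff {τ : Type*} [DecidableEq τ] (x y : τ) : eqb x y = true ↔ x = y :=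
  decide_eq_true_iff

/-- Types for which equality is decidable in polynomial time. -/
class PolyEq (α : Type) [Enc α] [DecidableEq α] : Prop where
  polyTime_eqb : PolyTime fun x : α × α => eqb x.1 x.2

namespace PolyTime

@[fun_prop]
theorem eqb [DecidableEq β] [PolyEq β] {f g : α → β} (hf : PolyTime f) (hg : PolyTime g) :
    PolyTime fun a => eqb (f a) (g a) :=
  PolyEq.polyTime_eqb.comp (hf.pair hg)

@[fun_prop]
theorem replicate {f : α → ℕ} {b : α → β} (hf : PolyTime f) (hb : PolyTime b) :
    PolyTime fun a => List.replicate (f a) (b a) := by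
  have h : PolyTime fun a => List.replicate (f a) false :=
    (of_enc_eq (f := fun n : ℕ => List.replicate n false) fun _ => rfl).comp hf
  have h' : PolyTime fun a => (List.replicate (f a) false).map fun _ => b a := by fun_prop
  simpa using h'

@[fun_prop]
theorem length {l : α → List β} (hl : PolyTime l) : PolyTime fun a => (l a).length := by
  have h : PolyTime fun a => (l a).map fun _ => false := by fun_prop
  refine congr_enc h fun a => ?_
  rw [List.map_const']
  rfl

@[fun_prop]
theorem drop {l : α → List β} {f : α → ℕ} (hl : PolyTime l) (hf : PolyTime f) :
    PolyTime fun a => (l a).drop (f a) := by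
  have h := foldl_growth (l := fun a => List.replicate (f a) false) (s := l)
    (g := fun _ s _ => s.tail) (by fun_prop) hl (by fun_prop)
    ⟨0, fun a t x _ => by simpa using esize_tail_le t⟩
  convert h using 2 with a
  generalize l a = l
  induction f a generalizing l with
  | zero => rfl
  | succ n ih =>
    rw [List.replicate_succ, List.foldl_cons, ← ih, List.drop_tail]

@[fun_prop]
theorem getD {l : α → List β} {f : α → ℕ} {d : α → β} (hl : PolyTime l) (hf : PolyTime f)
    (hd : PolyTime d) : PolyTime fun a => (l a).getD (f a) (d a) := by
  have h : PolyTime fun a => ((l a).drop (f a)).headD (d a) := by fun_prop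
  convert h using 2 with a
  rw [List.headD_eq_head?_getD, List.head?_drop, List.getD_eq_getElem?_getD]

@[fun_prop]
theorem range {f : α → ℕ} (hf : PolyTime f) : PolyTime fun a => List.range (f a) := by
  -- The next number is the length of the accumulator, so no separate counter is needed.
  have e : ∀ l : List Bool, l.foldl (fun acc _ => acc.length :: acc) [] =
      (List.range l.length).reverse := by
    intro l
    induction l using List.reverseRecOn with
    | nil => rfl
    | append_singleton l b ih => simp [ih, List.range_succ]
  obtain ⟨q, hq⟩ := hf.exists_bound
  have h := foldl (l := fun a => List.replicate (f a) false) (s := fun _ => [])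
    (g := fun _ acc _ => acc.length :: acc) (by fun_prop) (by fun_prop) (by fun_prop)
    (q * (2 * q + 2) + 1) (fun a l' hl' => by
      rw [e]
      refine (esize_le_of_forall (n := 2 * l'.length + 1) fun x hx => ?_).trans ?_
      · rw [List.mem_reverse, List.mem_range] at hx
        rw [esize_nat]
        omega
      · have h₁ := hl'.length_le
        have h₂ := hq a
        rw [List.length_replicate] at h₁
        rw [esize_nat] at h₂
        simp only [Polynomial.eval_add, Polynomial.eval_mul, Polynomial.eval_ofNat,
          Polynomial.eval_one, List.length_reverse, List.length_range]
        gcongr <;> omega)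
  simp only [e] at h
  simpa using h.reverse

end PolyTime

instance : PolyEq Bool where
  polyTime_eqb := by
    have h : PolyTime fun x : Bool × Bool => if x.1 = true then x.2 else !x.2 := by fun_prop
    convert h using 2 with x
    rcases x with ⟨_ | _, _ | _⟩ <;> rfl

instance [DecidableEq α] [DecidableEq β] [PolyEq α] [PolyEq β] : PolyEq (α × β) where
  polyTime_eqb := by
    have h : PolyTime fun x : (α × β) × (α × β) => eqb x.1.1 x.2.1 && eqb x.1.2 x.2.2 := by
      fun_prop
    convert h using 2 with x
    rw [Bool.eq_iff_iff]
    simp [Prod.ext_iff]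

instance : PolyEq ℕ where
  polyTime_eqb := by
    have h : PolyTime fun x : ℕ × ℕ =>
        ((List.replicate x.1 false).drop x.2).isEmpty &&
          ((List.replicate x.2 false).drop x.1).isEmpty := by
      fun_prop
    convert h using 2 with x
    rw [Bool.eq_iff_iff]
    simp
    omega

instance [DecidableEq α] [PolyEq α] : PolyEq (List α) where
  polyTime_eqb := by
    have h : PolyTime fun x : List α × List α =>
        eqb x.1.length x.2.length && (x.1.zip x.2).all fun y => eqb y.1 y.2 := by
      fun_prop
    convert h using 2 with x
    rw [Bool.eq_iff_iff]
    obtain ⟨l, l'⟩ := x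
    simp only [eqb_iff, Bool.and_eq_true, List.all_eq_true]
    have h := List.forall₂_iff_zip (R := (· = ·)) (l₁ := l) (l₂ := l')
    rw [List.forall₂_eq_eq_eq] at h
    rw [h]
    simp only [Prod.forall]

end StackProg

namespace StackProg

variable {α β γ δ σ : Type} [Enc α] [Enc β] [Enc γ] [Enc δ] [Enc σ]

/-! ### Binary arithmetic -/

/-- The number denoted by a list of binary digits, least significant digit first. -/
def bval : List Bool → ℕ
  | [] => 0
  | b :: l => b.toNat + 2 * bval l

theorem bval_append (l l' : List Bool) : bval (l ++ l') = bval l + 2 ^ l.length * bval l' := by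
  induction l with
  | nil => simp [bval]
  | cons b l ih =>
    rw [List.cons_append, bval, bval, ih, List.length_cons]
    ring

/-- One step of the addition: the state consists of the carry, the remaining digits of the second
summand, and the digits of the sum in reversed order. -/
def addStep (s : Bool × List Bool × List Bool) (x : Bool) : Bool × List Bool × List Bool :=
  ((x && s.2.1.headD false) || (s.1 && (x || s.2.1.headD false)), s.2.1.tail,
    eqb (eqb x (s.2.1.headD false)) s.1 :: s.2.2)

/-- The loop of the addition. -/
def addLoop (x : List Bool) (s : Bool × List Bool × List Bool) : Bool × List Bool × List Bool :=
  x.foldl addStep s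

/-- The final step of the addition. -/
def addEnd (s : Bool × List Bool × List Bool) : List Bool :=
  (s.1 :: s.2.2).reverse

/-- The sum of two binary numbers. -/
def addBits (x y : List Bool) : List Bool :=
  addEnd (addLoop (addLoop x (false, y, [])).2.1
    ((addLoop x (false, y, [])).1, [], (addLoop x (false, y, [])).2.2))

/-- Loop invariant: the digits already written, plus the carry and all unread digits shifted by
their number, have a constant value. Reading `false` past the end of the second summand is harmless.
-/
theorem bval_addLoop (x : List Bool) (s : Bool × List Bool × List Bool) :
    bval (addLoop x s).2.2.reverse +
        2 ^ (addLoop x s).2.2.length * ((addLoop x s).1.toNat + bval (addLoop x s).2.1) =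
      bval s.2.2.reverse + 2 ^ s.2.2.length * (s.1.toNat + bval s.2.1 + bval x) := by
  induction x generalizing s with
  | nil => rfl
  | cons b x ih =>
    change bval (addLoop x (addStep s b)).2.2.reverse + 2 ^ (addLoop x (addStep s b)).2.2.length *
      ((addLoop x (addStep s b)).1.toNat + bval (addLoop x (addStep s b)).2.1) = _
    rw [ih]
    obtain ⟨c, y, o⟩ := s
    simp only [addStep, List.reverse_cons, bval_append, List.length_reverse, List.length_cons]
    have hy : bval y = (y.headD false).toNat + 2 * bval y.tail := by
      cases y <;> rfl
    rw [hy, bval]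
    generalize y.headD false = d
    rw [pow_succ]
    cases b <;> cases c <;> cases d <;> simp [bval, eqb] <;> ring

theorem length_addLoop (x : List Bool) (s : Bool × List Bool × List Bool) :
    (addLoop x s).2.2.length = x.length + s.2.2.length ∧
      (addLoop x s).2.1 = s.2.1.drop x.length := by
  induction x generalizing s with
  | nil => simp [addLoop]
  | cons b x ih =>
    have := ih (addStep s b)
    refine ⟨this.1.trans ?_, this.2.trans ?_⟩
    · simp [addStep]
      omega
    · simp [addStep]

/-- The first loop may end before the digits of `y` do; the second one propagates the carry through
what is left, by adding it to the empty number. -/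
theorem bval_addBits (x y : List Bool) : bval (addBits x y) = bval x + bval y := by
  have h₁ := bval_addLoop x (false, y, [])
  have h₂ := bval_addLoop (addLoop x (false, y, [])).2.1
    ((addLoop x (false, y, [])).1, [], (addLoop x (false, y, [])).2.2)
  have h₃ := (length_addLoop (addLoop x (false, y, [])).2.1
    ((addLoop x (false, y, [])).1, [], (addLoop x (false, y, [])).2.2)).2
  rw [h₃] at h₂
  simp only [addBits, addEnd, List.reverse_cons, bval_append, List.length_reverse]
  simp only [bval, List.drop_nil] at *
  simp only [List.reverse_nil, bval, List.length_nil] at h₁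
  simp only [Bool.toNat_false, mul_zero, add_zero, zero_add, pow_zero, one_mul] at *
  omega

theorem length_addBits (x y : List Bool) :
    (addBits x y).length = max x.length y.length + 1 := by
  simp [addBits, addEnd, length_addLoop]
  omega

/-- The product of two binary numbers. -/
def mulBits (x y : List Bool) : List Bool :=
  x.foldr (fun b acc => addBits (if b = true then y else []) (false :: acc)) []

theorem bval_mulBits (x y : List Bool) : bval (mulBits x y) = bval x * bval y := by
  induction x with
  | nil => simp [mulBits, bval]
  | cons b x ih =>
    rw [mulBits, List.foldr_cons, bval_addBits, bval, bval]
    change _ + (_ + 2 * bval (mulBits x y)) = _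
    rw [ih]
    cases b <;> simp [bval] <;> ring

/-- Each digit of `x` costs one place for the shift and one for the carry. -/
theorem length_mulBits_le (x y : List Bool) :
    (mulBits x y).length ≤ 2 * x.length + y.length := by
  induction x with
  | nil => simp [mulBits]
  | cons b x ih =>
    rw [mulBits, List.foldr_cons, length_addBits, List.length_cons]
    change max _ ((mulBits x y).length + 1) + 1 ≤ _
    split <;> simp <;> omega

/-- The loop of the comparison: the state consists of the remaining digits of the second number
and the result for the digits seen so far. -/
def leLoop (x : List Bool) (s : List Bool × Bool) : List Bool × Bool :=
  x.foldl (fun s b => (s.1.tail, if eqb b (s.1.headD false) = true then s.2 else !b)) s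

/-- The comparison of two binary numbers. -/
def leBits (x y : List Bool) : Bool :=
  (leLoop x (y, true)).2 || (leLoop x (y, true)).1.any fun b => b

/-- Digits come least significant first, so a later difference overrides the earlier verdict `r`. A
`true` left over in `y` overrides everything. -/
theorem leLoop_iff (x y : List Bool) (r : Bool) :
    ((leLoop x (y, r)).2 || (leLoop x (y, r)).1.any fun b => b) = true ↔
      bval x < bval y ∨ bval x = bval y ∧ r = true := by
  induction x generalizing y r with
  | nil =>
    have : ∀ y : List Bool, (y.any fun b => b) = true ↔ 0 < bval y := by
      intro y
      induction y with
      | nil => simp [bval]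
      | cons b y ih =>
        rw [List.any_cons, Bool.or_eq_true, ih, bval]
        cases b <;> simp
    change (r || y.any fun b => b) = true ↔ 0 < bval y ∨ 0 = bval y ∧ r = true
    rw [Bool.or_eq_true, this]
    rcases Nat.eq_zero_or_pos (bval y) with h | h <;> simp [h]
  | cons b x ih =>
    have hy : bval y = (y.headD false).toNat + 2 * bval y.tail := by
      cases y <;> rfl
    change ((leLoop x (y.tail, _)).2 || (leLoop x (y.tail, _)).1.any fun b => b) = true ↔ _
    rw [ih, hy, bval]
    generalize y.headD false = d
    cases b <;> cases d <;> simp [eqb] <;> omega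

theorem leBits_iff (x y : List Bool) : leBits x y = true ↔ bval x ≤ bval y := by
  rw [leBits, leLoop_iff, le_iff_lt_or_eq]
  simp

namespace PolyTime

theorem addLoop {x : α → List Bool} {s : α → Bool × List Bool × List Bool} (hx : PolyTime x)
    (hs : PolyTime s) : PolyTime fun a => addLoop (x a) (s a) := by
  refine foldl_growth (g := fun _ s b => addStep s b) hx hs ?_ ⟨10, fun a t b _ => ?_⟩
  · unfold addStep
    fun_prop
  · have h₁ := esize_bool_le (addStep t b).1
    have h₂ := esize_bool_le (StackProg.eqb (StackProg.eqb b (t.2.1.headD false)) t.1)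
    have h₃ := esize_tail_le t.2.1
    rw [addStep] at h₁ ⊢
    simp only [esize_prod, esize_cons, Polynomial.eval_ofNat] at *
    omega

attribute [fun_prop] addLoop

@[fun_prop]
theorem addBits {x y : α → List Bool} (hx : PolyTime x) (hy : PolyTime y) :
    PolyTime fun a => addBits (x a) (y a) := by
  unfold StackProg.addBits addEnd
  fun_prop

@[fun_prop]
theorem mulBits {x y : α → List Bool} (hx : PolyTime x) (hy : PolyTime y) :
    PolyTime fun a => mulBits (x a) (y a) := by
  obtain ⟨qx, hqx⟩ := hx.exists_bound
  obtain ⟨qy, hqy⟩ := hy.exists_bound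
  have h := foldl (s := fun _ => []) (g := fun a acc b =>
    StackProg.addBits (if b = true then y a else []) (false :: acc)) hx.reverse (by fun_prop)
    (by fun_prop) (4 * (2 * qx + qy) + 1) (fun a l' hl' => by
      -- Every intermediate state is itself a product, so the length bound for products applies to
      -- it.
      have e : l'.foldl (fun acc b => StackProg.addBits (if b = true then y a else [])
          (false :: acc)) [] = StackProg.mulBits l'.reverse (y a) := by
        rw [StackProg.mulBits, List.foldr_reverse]
      have h₁ := hl'.length_le
      have h₂ := length_le_esize (x a)
      have h₃ := length_le_esize (y a)
      have h₄ := hqx a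
      have h₅ := hqy a
      have h₆ := length_mulBits_le l'.reverse (y a)
      rw [e]
      refine (esize_bits_le _).trans ?_
      simp only [List.length_reverse, Polynomial.eval_add, Polynomial.eval_mul,
        Polynomial.eval_ofNat, Polynomial.eval_one] at *
      omega)
  convert h using 2 with a
  rw [List.foldl_reverse]
  rfl

@[fun_prop]
theorem leBits {x y : α → List Bool} (hx : PolyTime x) (hy : PolyTime y) :
    PolyTime fun a => leBits (x a) (y a) := by
  have h : PolyTime fun a => leLoop (x a) (y a, true) := by
    refine foldl_growth (s := fun a => (y a, true)) (g := fun _ s b => (s.1.tail,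
      if StackProg.eqb b (s.1.headD false) = true then s.2 else !b)) hx (by fun_prop) (by fun_prop)
      ⟨3, fun a t b _ => ?_⟩
    have h₁ := esize_bool_le (if StackProg.eqb b (t.1.headD false) = true then t.2 else !b)
    have h₃ := esize_tail_le t.1
    simp only [esize_prod, Polynomial.eval_ofNat]
    omega
  unfold StackProg.leBits
  fun_prop

end PolyTime

/-! ### Sums of fractions -/

/-- A fraction: whether it has a minus sign, and the binary digits of its numerator and its
denominator. -/
abbrev RawFrac : Type := Bool × List Bool × List Bool

/-- The rational number that a fraction denotes. -/
def RawFrac.val (x : RawFrac) : ℚ := (if x.1 = true then -1 else 1) * bval x.2.1 / bval x.2.2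

/-- The fraction with the opposite sign. -/
def RawFrac.neg (x : RawFrac) : RawFrac := (!x.1, x.2)

theorem RawFrac.val_neg (x : RawFrac) : x.neg.val = -x.val := by
  rcases x with ⟨_ | _, x⟩ <;> simp [RawFrac.neg, RawFrac.val] <;> ring

/-- One step of the summation: the state consists of the positive and the negative part of the
numerator and of the denominator. -/
def sumStep (s : List Bool × List Bool × List Bool) (x : RawFrac) :
    List Bool × List Bool × List Bool :=
  (addBits (mulBits x.2.2 s.1) (if x.1 = true then [] else mulBits x.2.1 s.2.2),
    addBits (mulBits x.2.2 s.2.1) (if x.1 = true then mulBits x.2.1 s.2.2 else []),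
    mulBits x.2.2 s.2.2)

/-- The loop of the summation. -/
def sumLoop (l : List RawFrac) : List Bool × List Bool × List Bool :=
  l.foldl sumStep ([], [], [true])

/-- Whether the sum of a list of fractions is at most zero. -/
def sumNonpos (l : List RawFrac) : Bool :=
  leBits (sumLoop l).1 (sumLoop l).2.1

/-- Whether the sum of a list of fractions is zero. -/
def sumZero (l : List RawFrac) : Bool :=
  sumNonpos l && sumNonpos (l.map RawFrac.neg)

/-- Cross-multiplication, with the numerator kept as a difference of naturals. As the common
denominator is positive, the sign of the sum is found by one comparison, without subtraction. -/
theorem sumLoop_spec (l : List RawFrac) (h : ∀ x ∈ l, 0 < bval x.2.2) :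
    0 < bval (sumLoop l).2.2 ∧ ((bval (sumLoop l).1 : ℚ) - bval (sumLoop l).2.1) =
      bval (sumLoop l).2.2 * (l.map RawFrac.val).sum := by
  induction l using List.reverseRecOn with
  | nil => simp [sumLoop, bval]
  | append_singleton l x ih =>
    obtain ⟨h₁, h₂⟩ := ih fun y hy => h y (by simp [hy])
    have hx := h x (by simp)
    have hx' : (bval x.2.2 : ℚ) ≠ 0 := by positivity
    have e : sumLoop (l ++ [x]) = sumStep (sumLoop l) x := by
      rw [sumLoop, List.foldl_append]
      rfl
    rw [e, sumStep]
    refine ⟨by rw [bval_mulBits]; positivity, ?_⟩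
    rw [List.map_append, List.sum_append, List.map_singleton, List.sum_singleton]
    obtain ⟨_ | _, n, d⟩ := x
    · simp only [bval_addBits, bval_mulBits, RawFrac.val, Bool.false_eq_true, if_false, bval]
      push_cast
      field_simp
      linear_combination (bval d : ℚ) * h₂
    · simp only [bval_addBits, bval_mulBits, RawFrac.val, if_true, bval]
      push_cast
      field_simp
      linear_combination (bval d : ℚ) * h₂

theorem sumNonpos_iff {l : List RawFrac} (h : ∀ x ∈ l, 0 < bval x.2.2) :
    sumNonpos l = true ↔ (l.map RawFrac.val).sum ≤ 0 := by
  obtain ⟨h₁, h₂⟩ := sumLoop_spec l h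
  have h₁' : (0 : ℚ) < bval (sumLoop l).2.2 := by exact_mod_cast h₁
  rw [sumNonpos, leBits_iff, ← Nat.cast_le (α := ℚ), ← sub_nonpos, h₂]
  exact ⟨fun h => nonpos_of_mul_nonpos_right h h₁', fun h =>
    mul_nonpos_of_nonneg_of_nonpos h₁'.le h⟩

theorem sumZero_iff {l : List RawFrac} (h : ∀ x ∈ l, 0 < bval x.2.2) :
    sumZero l = true ↔ (l.map RawFrac.val).sum = 0 := by
  have e : ((l.map RawFrac.neg).map RawFrac.val).sum = -(l.map RawFrac.val).sum := by
    induction l with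
    | nil => simp
    | cons x l ih =>
      rw [List.map_cons, List.map_cons, List.sum_cons, ih fun y hy => h y (by simp [hy]),
        RawFrac.val_neg, List.map_cons, List.sum_cons]
      ring
  rw [sumZero, Bool.and_eq_true, sumNonpos_iff h, sumNonpos_iff, e]
  · constructor
    · rintro ⟨h₁, h₂⟩
      linarith
    · intro h
      rw [h]
      simp
  · intro x hx
    obtain ⟨y, hy, rfl⟩ := List.mem_map.1 hx
    exact h y hy

/-- A step lengthens the numbers by at most about twice the digits of the new fraction, and a tree
for m digits has size at least 2m + 1. The unreduced sum therefore stays linear in the size of the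
list. -/
theorem length_sumLoop_le (l : List RawFrac) :
    (sumLoop l).1.length ≤ esize l ∧ (sumLoop l).2.1.length ≤ esize l ∧
      (sumLoop l).2.2.length ≤ esize l := by
  induction l using List.reverseRecOn with
  | nil => decide
  | append_singleton l x ih =>
    have e : sumLoop (l ++ [x]) = sumStep (sumLoop l) x := by
      rw [sumLoop, List.foldl_append]
      rfl
    have h₁ := esize_append l [x]
    have h₂ := length_le_esize x.2.1
    have h₃ := length_le_esize x.2.2
    have m₁ := length_mulBits_le x.2.2 (sumLoop l).1
    have m₂ := length_mulBits_le x.2.2 (sumLoop l).2.1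
    have m₃ := length_mulBits_le x.2.2 (sumLoop l).2.2
    have m₄ := length_mulBits_le x.2.1 (sumLoop l).2.2
    rw [esize_cons, esize_nil, esize_prod, esize_prod] at h₁
    rw [e, sumStep]
    simp only [length_addBits]
    refine ⟨?_, ?_, ?_⟩
    · split
      · simp only [List.length_nil]
        omega
      · omega
    · split
      · omega
      · simp only [List.length_nil]
        omega
    · omega

namespace PolyTime

@[fun_prop]
theorem sumLoop {l : α → List RawFrac} (hl : PolyTime l) : PolyTime fun a => sumLoop (l a) := by
  obtain ⟨q, hq⟩ := hl.exists_bound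
  refine foldl (g := fun _ s x => sumStep s x) hl (by fun_prop) ?_ (12 * q + 5) fun a l' hl' => ?_
  · unfold sumStep
    fun_prop
  · have h₁ := length_sumLoop_le l'
    obtain ⟨l'', e⟩ := hl'
    have h₂ := esize_append l' l''
    have h₃ := esize_pos l''
    have h₄ := hq a
    have b₁ := esize_bits_le (StackProg.sumLoop l').1
    have b₂ := esize_bits_le (StackProg.sumLoop l').2.1
    have b₃ := esize_bits_le (StackProg.sumLoop l').2.2
    change esize (StackProg.sumLoop l') ≤ _
    rw [esize_prod, esize_prod]
    simp only [Polynomial.eval_add, Polynomial.eval_mul, Polynomial.eval_ofNat]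
    rw [← e] at h₄
    omega

@[fun_prop]
theorem sumNonpos {l : α → List RawFrac} (hl : PolyTime l) :
    PolyTime fun a => sumNonpos (l a) := by
  unfold StackProg.sumNonpos
  fun_prop

@[fun_prop]
theorem sumZero {l : α → List RawFrac} (hl : PolyTime l) : PolyTime fun a => sumZero (l a) := by
  unfold StackProg.sumZero RawFrac.neg
  fun_prop

end PolyTime

end StackProg

namespace StackProg

/-! ### Splitting words -/

section

variable {β : Type}

/-- One step of `splitAtEnds`: the state consists of the current piece and of the finished pieces,
both reversed. -/
def splitStep [DecidableEq β] (sep : β) (s : List β × List (List β)) (b : β) :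
    List β × List (List β) :=
  if eqb b sep = true then ([], s.1.reverse :: s.2) else (b :: s.1, s.2)

/-- The pieces of a word each of which is ended by a given letter. -/
def splitAtEnds [DecidableEq β] (sep : β) (w : List β) : List (List β) :=
  (w.foldl (splitStep sep) ([], [])).2.reverse

theorem foldl_splitStep_of_notMem [DecidableEq β] {sep : β} {u : List β} (hu : sep ∉ u)
    (s : List β × List (List β)) :
    u.foldl (splitStep sep) s = (u.reverse ++ s.1, s.2) := by
  induction u generalizing s with
  | nil => rfl
  | cons b u ih =>
    rw [List.mem_cons, not_or] at hu
    rw [List.foldl_cons, ih hu.2, splitStep, if_neg (by simpa using Ne.symm hu.1)]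
    simp

theorem splitAtEnds_flatMap [DecidableEq β] {sep : β} {p : List (List β)}
    (hp : ∀ u ∈ p, sep ∉ u) : splitAtEnds sep (p.flatMap fun u => u ++ [sep]) = p := by
  have key : ∀ (p : List (List β)) (t : List (List β)), (∀ u ∈ p, sep ∉ u) →
      (p.flatMap fun u => u ++ [sep]).foldl (splitStep sep) ([], t) = ([], p.reverse ++ t) := by
    intro p
    induction p with
    | nil => exact fun t _ => rfl
    | cons u p ih =>
      intro t hp
      rw [List.flatMap_cons, List.foldl_append, List.foldl_append,
        foldl_splitStep_of_notMem (hp u (by simp)), List.foldl_cons, List.foldl_nil, splitStep,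
        if_pos (by simp), ih _ fun v hv => hp v (by simp [hv])]
      simp
  rw [splitAtEnds, key p [] hp]
  simp

/-- One step of `pairUp`: the state consists of the first component of an unfinished pair, if there
is one, and of the finished pairs in reversed order. -/
def pairStep (s : List β × List (β × β)) (b : β) : List β × List (β × β) :=
  if s.1.isEmpty = true then ([b], s.2) else ([], (s.1.headD b, b) :: s.2)

/-- The pairs of consecutive elements of a list. -/
def pairUp (l : List β) : List (β × β) :=
  (l.foldl pairStep ([], [])).2.reverse

theorem pairUp_flatMap (l : List (β × β)) : pairUp (l.flatMap fun x => [x.1, x.2]) = l := by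
  have key : ∀ (l t : List (β × β)),
      (l.flatMap fun x => [x.1, x.2]).foldl pairStep ([], t) = ([], l.reverse ++ t) := by
    intro l
    induction l with
    | nil => exact fun t => rfl
    | cons x l ih =>
      intro t
      rw [List.flatMap_cons, List.foldl_append]
      change List.foldl pairStep ([], (x.1, x.2) :: t) _ = _
      rw [ih]
      simp
  rw [pairUp, key]
  simp

end

namespace PolyTime

variable {α β : Type} [Enc α] [Enc β]

@[fun_prop]
theorem splitAtEnds [DecidableEq β] [PolyEq β] (sep : β) {w : α → List β} (hw : PolyTime w) :
    PolyTime fun a => splitAtEnds sep (w a) := by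
  obtain ⟨q, hq⟩ := hw.exists_bound
  have h := foldl_growth (s := fun _ => ([], [])) (g := fun _ s b => splitStep sep s b) hw
    (by fun_prop) (by unfold splitStep; fun_prop) ⟨q + 2, fun a t b hb => by
      have h₁ := esize_le_of_mem hb
      have h₂ := hq a
      have h₃ := esize_reverse t.1
      rw [splitStep]
      split <;> simp [esize_prod, esize_cons, esize_nil] <;> omega⟩
  exact h.snd.reverse

@[fun_prop]
theorem pairUp {l : α → List β} (hl : PolyTime l) : PolyTime fun a => pairUp (l a) := by
  obtain ⟨q, hq⟩ := hl.exists_bound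
  have h := foldl_growth (s := fun _ => ([], [])) (g := fun _ s b => pairStep s b) hl
    (by fun_prop) (by unfold pairStep; fun_prop) ⟨q + 2, fun a t b hb => by
      have h₁ := esize_le_of_mem hb
      have h₂ := hq a
      rcases t with ⟨_ | ⟨c, t⟩, u⟩
      · simp [pairStep, esize_prod, esize_cons, esize_nil]
        omega
      · simp [pairStep, esize_prod, esize_cons, esize_nil]
        omega⟩
  exact h.snd.reverse

end PolyTime

end StackProg

/-! ### Words and raw descriptions of Hamiltonians -/

namespace LocalHam

open StackProg

/-- The number of a letter. -/
def Letter.index : Letter → ℕ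
  | .zero => 0
  | .one => 1
  | .minus => 2
  | .slash => 3
  | .comma => 4
  | .bar => 5

theorem Letter.index_injective : Function.Injective Letter.index := by
  intro a b
  cases a <;> cases b <;> simp [Letter.index]

instance : Enc Letter where
  enc a := Enc.enc a.index

instance : PolyEq Letter where
  polyTime_eqb := by
    have h : PolyTime Letter.index := PolyTime.of_enc_eq fun _ => rfl
    have h' : PolyTime fun x : Letter × Letter => eqb x.1.index x.2.index := by fun_prop
    convert h' using 2 with x
    rw [Bool.eq_iff_iff]
    simp [Letter.index_injective.eq_iff]

/-- A term: its support as a bit string, and the matrix entries row by row. -/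
abbrev RawTerm : Type := List Bool × List (RawFrac × RawFrac)

/-- A description of a Hamiltonian: the number of qubits and the terms. -/
abbrev RawHam : Type := ℕ × List RawTerm

/-! ### Encoding and decoding -/

/-- The encoding of a fraction. -/
def encodeFrac (x : RawFrac) : List Letter :=
  (if x.1 = true then [Letter.minus] else []) ++ x.2.1.map encodeBit ++ [Letter.slash] ++
    x.2.2.map encodeBit

/-- The encoding of a term. -/
def encodeTerm (t : RawTerm) : List Letter :=
  t.1.map encodeBit ++ [Letter.bar] ++
    (t.2.flatMap fun z =>
      encodeFrac z.1 ++ [Letter.comma] ++ encodeFrac z.2 ++ [Letter.comma]) ++ [Letter.bar]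

/-- The encoding of a Hamiltonian. -/
def encodeHam (r : RawHam) : List Letter :=
  List.replicate r.1 Letter.one ++ [Letter.bar] ++ r.2.flatMap encodeTerm

/-- The inverse of `encodeFrac`. -/
def decodeFrac (u : List Letter) : RawFrac :=
  (eqb (u.headD Letter.zero) Letter.minus,
    (((splitAtEnds Letter.slash (u ++ [Letter.slash])).headD []).filter
      fun a => !eqb a Letter.minus).map (fun a => eqb a Letter.one),
    ((splitAtEnds Letter.slash (u ++ [Letter.slash])).tail.headD []).map
      fun a => eqb a Letter.one)

/-- The inverse of `encodeTerm`, for the two pieces of a term. -/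
def decodeTerm (u : List Letter × List Letter) : RawTerm :=
  (u.1.map fun a => eqb a Letter.one,
    (pairUp (splitAtEnds Letter.comma u.2)).map fun z => (decodeFrac z.1, decodeFrac z.2))

/-- The inverse of `encodeHam`. -/
def decodeHam (w : List Letter) : RawHam :=
  (((splitAtEnds Letter.bar w).headD []).length,
    (pairUp (splitAtEnds Letter.bar w).tail).map decodeTerm)

/-! ### The decision procedure -/

/-- The entries of a list at the positions that are marked in another list. -/
def restrict (m x : List Bool) : List Bool :=
  ((m.zip x).filter fun p => p.1).map fun p => p.2

/-- A bit string as a list. -/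
def bits {n : ℕ} (x : Bits n) : List Bool := (List.finRange n).map fun q => eqb (x q) 1

/-- The positions in a matrix on `a` qubits, row by row. -/
def positions (a : ℕ) : List (List Bool × List Bool) :=
  (List.finRange (2 ^ a)).flatMap fun r => (List.finRange (2 ^ a)).map fun c =>
    (bits (bitsOf r), bits (bitsOf c))

/-- The positions in the matrix of a term on at most `k` qubits. -/
def termPositions (k : ℕ) (m : List Bool) : List (List Bool × List Bool) :=
  ((List.range (k + 1)).map positions).getD (m.filter fun b => b).length []

/-- The matrix entries of a term on at most `k` qubits, with their positions. -/
def entries (k : ℕ) (t : RawTerm) : List ((List Bool × List Bool) × (RawFrac × RawFrac)) :=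
  (termPositions k t.1).zip t.2

/-- Whether a binary number has no superfluous zeros. -/
def isCanonical (u : List Bool) : Bool := u.reverse.headD true

/-- Whether the description of a fraction is valid. -/
def fracOk (x : RawFrac) : Bool :=
  isCanonical x.2.1 && (isCanonical x.2.2 && (!x.2.2.isEmpty && (!x.1 || !x.2.1.isEmpty)))

/-- Whether the matrix of a term is Hermitian. -/
def hermOk (k : ℕ) (t : RawTerm) : Bool :=
  (entries k t).all fun e => (entries k t).all fun e' =>
    !eqb e.1 (e'.1.2, e'.1.1) ||
      (sumZero [e.2.1, e'.2.1.neg] && sumZero [e.2.2, e'.2.2])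

/-- Whether the description of a term is valid. -/
def termOk (k n : ℕ) (t : RawTerm) : Bool :=
  eqb t.1.length n && (((t.1.filter fun b => b).drop k).isEmpty &&
    (eqb t.2.length (termPositions k t.1).length &&
      ((t.2.all fun z => fracOk z.1 && fracOk z.2) && hermOk k t)))

/-- The qubits that share a term with qubit `i`, as a bit string. -/
def hood (r : RawHam) (i : ℕ) : List Bool :=
  (List.range r.1).map fun j => r.2.any fun t => t.1.getD i false && t.1.getD j false

/-- The bit string that has given entries at the marked positions and is zero elsewhere. -/
def spread (m b : List Bool) : List Bool :=
  (List.range m.length).map fun j =>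
    (((List.range m.length).filter fun i => m.getD i false).zip b).any fun p =>
      eqb p.1 j && p.2

/-- Whether two bit strings agree at the unmarked positions. -/
def agreeOff (m x y : List Bool) : Bool :=
  (m.zip (x.zip y)).all fun p => p.1 || eqb p.2.1 p.2.2

/-- The matrix entries of the terms that contribute to one matrix entry of the Hamiltonian. -/
def contributions (k : ℕ) (r : RawHam) (x y : List Bool) : List (RawFrac × RawFrac) :=
  r.2.flatMap fun t => if agreeOff t.1 x y = true then
    ((entries k t).filter fun e => eqb e.1 (restrict t.1 x, restrict t.1 y)).map fun e => e.2
  else []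

/-- Whether one matrix entry of the Hamiltonian is on the diagonal, or real and nonpositive. -/
def entryOk (k : ℕ) (r : RawHam) (x y : List Bool) : Bool :=
  eqb x y || (sumNonpos ((contributions k r x y).map fun z => z.1) &&
    sumZero ((contributions k r x y).map fun z => z.2))

/-- All bit strings of a given length. -/
noncomputable def allBits (m : ℕ) : List (List Bool) :=
  (Finset.univ : Finset (Fin m → Bool)).toList.map List.ofFn

/-- Whether a qubit interacts with at most `l` others, and the matrix entries of the Hamiltonian for
the bit strings that vanish on all other qubits are as they should be. -/
noncomputable def qubitOk (k l : ℕ) (r : RawHam) (i : ℕ) : Bool :=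
  (((hood r i).filter fun b => b).drop (l + 1)).isEmpty &&
    (allBits (l + 1)).all fun b => (allBits (l + 1)).all fun b' =>
      entryOk k r (spread (hood r i) b) (spread (hood r i) b')

/-- Whether a description of a Hamiltonian is valid and the Hamiltonian is globally stoquastic. -/
noncomputable def hamOk (k l : ℕ) (r : RawHam) : Bool :=
  (r.2.all fun t => termOk k r.1 t) && (List.range r.1).all fun i => qubitOk k l r i

/-- The decision procedure for global stoquasticity. -/
noncomputable def decideStoq (k l : ℕ) (w : List Letter) : Bool :=
  eqb (encodeHam (decodeHam w)) w && hamOk k l (decodeHam w)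

/-! ### Polynomial running time of the decision procedure -/

section

variable {α : Type} [Enc α]

@[fun_prop]
theorem polyTime_encodeBit {f : α → Bool} (hf : PolyTime f) :
    PolyTime fun a => encodeBit (f a) := by
  unfold encodeBit
  fun_prop

@[fun_prop]
theorem polyTime_encodeFrac {f : α → RawFrac} (hf : PolyTime f) :
    PolyTime fun a => encodeFrac (f a) := by
  unfold encodeFrac
  fun_prop

@[fun_prop]
theorem polyTime_encodeTerm {f : α → RawTerm} (hf : PolyTime f) :
    PolyTime fun a => encodeTerm (f a) := by
  unfold encodeTerm
  fun_prop

@[fun_prop]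
theorem polyTime_encodeHam {f : α → RawHam} (hf : PolyTime f) :
    PolyTime fun a => encodeHam (f a) := by
  unfold encodeHam
  fun_prop

@[fun_prop]
theorem polyTime_decodeFrac {f : α → List Letter} (hf : PolyTime f) :
    PolyTime fun a => decodeFrac (f a) := by
  unfold decodeFrac
  fun_prop

@[fun_prop]
theorem polyTime_decodeTerm {f : α → List Letter × List Letter} (hf : PolyTime f) :
    PolyTime fun a => decodeTerm (f a) := by
  unfold decodeTerm
  fun_prop

@[fun_prop]
theorem polyTime_decodeHam {f : α → List Letter} (hf : PolyTime f) :
    PolyTime fun a => decodeHam (f a) := by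
  unfold decodeHam
  fun_prop

@[fun_prop]
theorem polyTime_restrict {f g : α → List Bool} (hf : PolyTime f) (hg : PolyTime g) :
    PolyTime fun a => restrict (f a) (g a) := by
  unfold restrict
  fun_prop

@[fun_prop]
-- There are 4^a positions for arity a, but `k` is fixed: the table for all arities up to `k` is a
-- constant of the program, and only a lookup remains.
theorem polyTime_termPositions (k : ℕ) {f : α → List Bool} (hf : PolyTime f) :
    PolyTime fun a => termPositions k (f a) := by
  unfold termPositions
  fun_prop

@[fun_prop]
theorem polyTime_entries (k : ℕ) {f : α → RawTerm} (hf : PolyTime f) :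
    PolyTime fun a => entries k (f a) := by
  unfold entries
  fun_prop

@[fun_prop]
theorem polyTime_fracOk {f : α → RawFrac} (hf : PolyTime f) :
    PolyTime fun a => fracOk (f a) := by
  unfold fracOk isCanonical
  fun_prop

@[fun_prop]
theorem polyTime_hermOk (k : ℕ) {f : α → RawTerm} (hf : PolyTime f) :
    PolyTime fun a => hermOk k (f a) := by
  unfold hermOk RawFrac.neg
  fun_prop

@[fun_prop]
theorem polyTime_termOk (k : ℕ) {n : α → ℕ} {f : α → RawTerm} (hn : PolyTime n)
    (hf : PolyTime f) : PolyTime fun a => termOk k (n a) (f a) := by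
  unfold termOk
  fun_prop

@[fun_prop]
theorem polyTime_hood {r : α → RawHam} {i : α → ℕ} (hr : PolyTime r) (hi : PolyTime i) :
    PolyTime fun a => hood (r a) (i a) := by
  unfold hood
  fun_prop

@[fun_prop]
theorem polyTime_spread {f g : α → List Bool} (hf : PolyTime f) (hg : PolyTime g) :
    PolyTime fun a => spread (f a) (g a) := by
  unfold spread
  fun_prop

@[fun_prop]
theorem polyTime_agreeOff {f g h : α → List Bool} (hf : PolyTime f) (hg : PolyTime g)
    (hh : PolyTime h) : PolyTime fun a => agreeOff (f a) (g a) (h a) := by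
  unfold agreeOff
  fun_prop

@[fun_prop]
theorem polyTime_contributions (k : ℕ) {r : α → RawHam} {x y : α → List Bool} (hr : PolyTime r)
    (hx : PolyTime x) (hy : PolyTime y) :
    PolyTime fun a => contributions k (r a) (x a) (y a) := by
  unfold contributions
  fun_prop

@[fun_prop]
theorem polyTime_entryOk (k : ℕ) {r : α → RawHam} {x y : α → List Bool} (hr : PolyTime r)
    (hx : PolyTime x) (hy : PolyTime y) : PolyTime fun a => entryOk k (r a) (x a) (y a) := by
  unfold entryOk
  fun_prop

@[fun_prop]
-- The exponentially long list `allBits (l + 1)` is a constant, because `l` is fixed.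
theorem polyTime_qubitOk (k l : ℕ) {r : α → RawHam} {i : α → ℕ} (hr : PolyTime r)
    (hi : PolyTime i) : PolyTime fun a => qubitOk k l (r a) (i a) := by
  unfold qubitOk
  fun_prop

@[fun_prop]
theorem polyTime_hamOk (k l : ℕ) {r : α → RawHam} (hr : PolyTime r) :
    PolyTime fun a => hamOk k l (r a) := by
  unfold hamOk
  fun_prop

@[fun_prop]
theorem polyTime_decideStoq (k l : ℕ) {w : α → List Letter} (hw : PolyTime w) :
    PolyTime fun a => decideStoq k l (w a) := by
  unfold decideStoq
  fun_prop

end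

/-! ### The decoder inverts the encoder -/

theorem map_encodeBit_eqb (u : List Bool) :
    (u.map encodeBit).map (fun a => eqb a Letter.one) = u := by
  rw [List.map_map]
  conv_rhs => rw [← List.map_id u]
  refine List.map_congr_left fun b _ => ?_
  cases b <;> rfl

theorem notMem_map_encodeBit {a : Letter} (h₀ : a ≠ .zero) (h₁ : a ≠ .one) (u : List Bool) :
    a ∉ u.map encodeBit := by
  intro h
  obtain ⟨b, -, rfl⟩ := List.mem_map.1 h
  cases b
  · exact h₀ rfl
  · exact h₁ rfl

theorem notMem_encodeFrac {a : Letter} (h₀ : a ≠ .zero) (h₁ : a ≠ .one) (h₂ : a ≠ .minus)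
    (h₃ : a ≠ .slash) (x : RawFrac) : a ∉ encodeFrac x := by
  have h₄ := notMem_map_encodeBit h₀ h₁ x.2.1
  have h₅ := notMem_map_encodeBit h₀ h₁ x.2.2
  unfold encodeFrac
  split <;> simp only [List.mem_append, List.mem_singleton, List.not_mem_nil, h₂, h₃, h₄, h₅,
    or_self, not_false_eq_true]

theorem decodeFrac_encodeFrac (x : RawFrac) : decodeFrac (encodeFrac x) = x := by
  obtain ⟨s, u, v⟩ := x
  have hs : splitAtEnds Letter.slash (encodeFrac (s, u, v) ++ [Letter.slash]) =
      [(if s = true then [Letter.minus] else []) ++ u.map encodeBit, v.map encodeBit] := by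
    rw [← splitAtEnds_flatMap (sep := Letter.slash)
      (p := [(if s = true then [Letter.minus] else []) ++ u.map encodeBit, v.map encodeBit])]
    · simp [encodeFrac]
    · have h₁ := notMem_map_encodeBit (a := .slash) nofun nofun u
      have h₂ := notMem_map_encodeBit (a := .slash) nofun nofun v
      intro w hw
      rcases List.mem_cons.1 hw with rfl | hw
      · rw [List.mem_append, not_or]
        refine ⟨?_, h₁⟩
        split <;> simp
      · rw [List.mem_singleton.1 hw]
        exact h₂
  have hf : (u.map encodeBit).filter (fun a => !eqb a Letter.minus) = u.map encodeBit := by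
    refine List.filter_eq_self.2 fun a ha => ?_
    obtain ⟨b, -, rfl⟩ := List.mem_map.1 ha
    cases b <;> rfl
  rw [decodeFrac, hs]
  refine Prod.ext ?_ (Prod.ext ?_ (map_encodeBit_eqb v))
  · cases s
    · rcases u with _ | ⟨_ | _, u⟩ <;> rfl
    · rfl
  · refine (congrArg (List.map _) (?_ : _ = u.map encodeBit)).trans (map_encodeBit_eqb u)
    refine Eq.trans ?_ hf
    cases s <;> rfl

theorem decodeTerm_encodeTerm (t : RawTerm) :
    decodeTerm (t.1.map encodeBit, t.2.flatMap fun z =>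
      encodeFrac z.1 ++ [Letter.comma] ++ encodeFrac z.2 ++ [Letter.comma]) = t := by
  have h : (t.2.flatMap fun z =>
      encodeFrac z.1 ++ [Letter.comma] ++ encodeFrac z.2 ++ [Letter.comma]) =
      ((t.2.map fun z => (encodeFrac z.1, encodeFrac z.2)).flatMap fun x =>
        [x.1, x.2]).flatMap fun u => u ++ [Letter.comma] := by
    rw [List.flatMap_assoc, List.flatMap_map]
    congr 1
    funext z
    simp
  refine Prod.ext (map_encodeBit_eqb _) ?_
  rw [decodeTerm]
  dsimp only
  rw [h, splitAtEnds_flatMap, pairUp_flatMap, List.map_map]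
  · conv_rhs => rw [← List.map_id t.2]
    refine List.map_congr_left fun z _ => ?_
    simp [decodeFrac_encodeFrac]
  · intro u hu
    obtain ⟨x, hx, hu⟩ := List.mem_flatMap.1 hu
    obtain ⟨z, -, rfl⟩ := List.mem_map.1 hx
    rcases List.mem_cons.1 hu with rfl | hu
    · exact notMem_encodeFrac (a := .comma) nofun nofun nofun nofun _
    · rw [List.mem_singleton.1 hu]
      exact notMem_encodeFrac (a := .comma) nofun nofun nofun nofun _

theorem decodeHam_encodeHam (r : RawHam) : decodeHam (encodeHam r) = r := by
  have h : encodeHam r = (List.replicate r.1 Letter.one ::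
      (r.2.map fun t => (t.1.map encodeBit, t.2.flatMap fun z =>
        encodeFrac z.1 ++ [Letter.comma] ++ encodeFrac z.2 ++ [Letter.comma])).flatMap fun x =>
          [x.1, x.2]).flatMap fun u => u ++ [Letter.bar] := by
    rw [List.flatMap_cons, List.flatMap_assoc, List.flatMap_map, encodeHam]
    congr 2
    funext t
    simp [encodeTerm]
  rw [decodeHam, h, splitAtEnds_flatMap]
  · refine Prod.ext List.length_replicate ?_
    rw [List.tail_cons, pairUp_flatMap, List.map_map]
    conv_rhs => rw [← List.map_id r.2]
    exact List.map_congr_left fun t _ => decodeTerm_encodeTerm t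
  · intro u hu
    rcases List.mem_cons.1 hu with rfl | hu
    · simp
    obtain ⟨x, hx, hu⟩ := List.mem_flatMap.1 hu
    obtain ⟨t, -, rfl⟩ := List.mem_map.1 hx
    rcases List.mem_cons.1 hu with rfl | hu
    · exact notMem_map_encodeBit (a := .bar) nofun nofun _
    · rw [List.mem_singleton.1 hu, List.mem_flatMap]
      rintro ⟨z, -, hz⟩
      have h₁ := notMem_encodeFrac (a := .bar) nofun nofun nofun nofun z.1
      have h₂ := notMem_encodeFrac (a := .bar) nofun nofun nofun nofun z.2
      simp [h₁, h₂] at hz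

/-- The decoder returns something for malformed words too; encoding its result again and comparing
rejects these. -/
theorem decideStoq_iff (k l : ℕ) (w : List Letter) :
    decideStoq k l w = true ↔ ∃ r, encodeHam r = w ∧ hamOk k l r = true := by
  rw [decideStoq, Bool.and_eq_true, eqb_iff]
  constructor
  · rintro ⟨h₁, h₂⟩
    exact ⟨_, h₁, h₂⟩
  · rintro ⟨r, rfl, h⟩
    rw [decodeHam_encodeHam]
    exact ⟨rfl, h⟩

/-! ### Binary numbers -/

theorem isCanonical_cons (b : Bool) (u : List Bool) :
    isCanonical (b :: u) = if u = [] then b else isCanonical u := by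
  rw [isCanonical, isCanonical, List.reverse_cons]
  rcases List.eq_nil_or_concat u with rfl | ⟨v, c, rfl⟩ <;> simp

theorem bval_pos {u : List Bool} (h : isCanonical u = true) (hu : u ≠ []) : 0 < bval u := by
  induction u with
  | nil => exact absurd rfl hu
  | cons b u ih =>
    rw [isCanonical_cons] at h
    rw [bval]
    split at h
    · rw [h]
      simp
    · have := ih h ‹_›
      omega

/-- Parity determines the lowest digit and halving the others; canonicity rules out that a nonempty
expansion denotes zero. -/
theorem bval_injOn {u v : List Bool} (hu : isCanonical u = true) (hv : isCanonical v = true)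
    (h : bval u = bval v) : u = v := by
  induction u generalizing v with
  | nil =>
    by_contra hne
    have := bval_pos hv (Ne.symm hne)
    rw [← h] at this
    exact absurd this (by simp [bval])
  | cons b u ih =>
    rcases v with _ | ⟨c, v⟩
    · have := bval_pos hu (by simp)
      rw [h] at this
      exact absurd this (by simp [bval])
    have hu' : isCanonical u = true := by
      rw [isCanonical_cons] at hu
      split at hu
      · simp [*, isCanonical]
      · exact hu
    have hv' : isCanonical v = true := by
      rw [isCanonical_cons] at hv
      split at hv
      · simp [*, isCanonical]
      · exact hv
    rw [bval, bval] at h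
    have h₁ : b = c := by
      cases b <;> cases c <;> simp at h ⊢ <;> omega
    rw [h₁, ih hu' hv' (by rw [h₁] at h; omega)]

theorem bval_encodePosNum (p : PosNum) : bval (Computability.encodePosNum p) = (p : ℕ) := by
  induction p with
  | one => rfl
  | bit0 p ih =>
    rw [Computability.encodePosNum, bval, ih, PosNum.cast_bit0]
    simp
    ring
  | bit1 p ih =>
    rw [Computability.encodePosNum, bval, ih, PosNum.cast_bit1]
    simp
    ring

theorem bval_encodeNat (m : ℕ) : bval (Computability.encodeNat m) = m := by
  have h : ∀ x : Num, bval (Computability.encodeNum x) = (x : ℕ)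
    | .zero => rfl
    | .pos p => bval_encodePosNum p
  rw [Computability.encodeNat, h]
  exact Num.to_of_nat m

theorem isCanonical_encodeNat (m : ℕ) : isCanonical (Computability.encodeNat m) = true := by
  have h : ∀ p : PosNum, isCanonical (Computability.encodePosNum p) = true := by
    intro p
    induction p with
    | one => rfl
    | bit0 p ih | bit1 p ih =>
      rw [Computability.encodePosNum, isCanonical_cons,
        if_neg (Computability.encodePosNum_nonempty p), ih]
  rw [Computability.encodeNat]
  generalize (m : Num) = x
  cases x with
  | zero => rfl
  | pos p => exact h p

theorem encodeNat_bval {u : List Bool} (h : isCanonical u = true) :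
    Computability.encodeNat (bval u) = u :=
  bval_injOn (isCanonical_encodeNat _) h (bval_encodeNat _)

/-! ### Descriptions of Hamiltonians -/

/-- The description of a fraction. -/
def rawFrac (a : Frac) : RawFrac :=
  (decide (a.num < 0), Computability.encodeNat a.num.natAbs, Computability.encodeNat a.den)

/-- The description of a complex number. -/
def rawEntry (z : GaussFrac) : RawFrac × RawFrac := (rawFrac z.re, rawFrac z.im)

/-- The description of a term with given support and matrix. -/
def rawTermOf {n a : ℕ} (site : Fin a ↪o Fin n) (mat : Matrix (Bits a) (Bits a) GaussFrac) :
    RawTerm :=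
  ((List.finRange n).map (fun q => decide (q ∈ Finset.univ.map site.toEmbedding)),
    (List.finRange (2 ^ a)).flatMap fun r =>
      (List.finRange (2 ^ a)).map fun c => rawEntry (mat (bitsOf r) (bitsOf c)))

/-- The description of a term. -/
def rawTerm {n : ℕ} (t : Term n) : RawTerm := rawTermOf t.site t.mat

/-- The description of a Hamiltonian. -/
def rawHam (H : Hamiltonian) : RawHam := (H.n, H.terms.map rawTerm)

theorem encodeFrac_rawFrac (a : Frac) : encodeFrac (rawFrac a) = a.encode := by
  simp [encodeFrac, rawFrac, Frac.encode, encodeNat]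

theorem encodeTerm_rawTerm {n : ℕ} (t : Term n) : encodeTerm (rawTerm t) = t.encode := by
  rw [encodeTerm, rawTerm, rawTermOf, Term.encode]
  simp only [List.map_map, List.flatMap_assoc, List.flatMap_map]
  simp only [rawEntry, encodeFrac_rawFrac]
  rfl

theorem encodeHam_rawHam (H : Hamiltonian) : encodeHam (rawHam H) = H.encode := by
  rw [encodeHam, rawHam, Hamiltonian.encode]
  simp only [List.flatMap_map, encodeTerm_rawTerm]

/-- With canonical digits, nonempty means positive. So the test demands a positive denominator and
forbids a minus sign in front of zero, which is never written. -/
theorem fracOk_iff (x : RawFrac) : fracOk x = true ↔ ∃ a, rawFrac a = x := by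
  constructor
  · obtain ⟨s, u, v⟩ := x
    simp only [fracOk, Bool.and_eq_true, Bool.or_eq_true, Bool.not_eq_true', List.isEmpty_eq_false_iff]
    rintro ⟨hu, hv, hv', hs⟩
    refine ⟨⟨if s = true then -(bval u : ℤ) else bval u, bval v, bval_pos hv hv'⟩, ?_⟩
    refine Prod.ext ?_ (Prod.ext ?_ (encodeNat_bval hv))
    · cases s
      · simp [rawFrac]
      · have := bval_pos hu (by simpa using hs)
        simp [rawFrac, this]
    · have : (if s = true then -(bval u : ℤ) else bval u).natAbs = bval u := by
        split <;> simp
      simp only [rawFrac]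
      rw [this, encodeNat_bval hu]
  · rintro ⟨a, rfl⟩
    have h : ∀ m, 0 < m → (Computability.encodeNat m).isEmpty = false := by
      intro m hm
      rw [List.isEmpty_eq_false_iff]
      intro h
      have := bval_encodeNat m
      rw [h, bval] at this
      omega
    simp only [fracOk, rawFrac, isCanonical_encodeNat, h _ a.den_pos, Bool.true_and, Bool.not_false]
    by_cases ha : a.num < 0
    · rw [h _ (by omega)]
      simp
    · simp [ha]

theorem val_rawFrac (a : Frac) : (rawFrac a).val = a.val := by
  rw [rawFrac, RawFrac.val, Frac.val, bval_encodeNat, bval_encodeNat]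
  congr 1
  by_cases ha : a.num < 0
  · simp [ha, abs_of_neg ha]
  · simp [ha, abs_of_nonneg (not_lt.1 ha)]

theorem bval_den_rawFrac (a : Frac) : 0 < bval (rawFrac a).2.2 := by
  rw [rawFrac, bval_encodeNat]
  exact a.den_pos

theorem length_bits {n : ℕ} (x : Bits n) : (bits x).length = n := by simp [bits]

theorem bits_injective {n : ℕ} : Function.Injective (bits (n := n)) := by
  intro x y h
  funext q
  have := List.map_inj_left.1 h q (List.mem_finRange q)
  rw [Bool.eq_iff_iff, eqb_iff, eqb_iff] at this
  generalize x q = a at *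
  generalize y q = b at *
  fin_cases a <;> fin_cases b <;> simp_all

theorem bitsOf_bijective {a : ℕ} : Function.Bijective (bitsOf (m := a)) :=
  finFunctionFinEquiv.symm.bijective

section Term

variable {n a : ℕ} (site : Fin a ↪o Fin n) (mat : Matrix (Bits a) (Bits a) GaussFrac)

/-- Both lists are strictly increasing with the same members. Here the increasing order of the sites
matters: the support alone determines how the rows and columns are indexed. -/
theorem filter_finRange_support :
    (List.finRange n).filter (fun q => decide (q ∈ Finset.univ.map site.toEmbedding)) =
      (List.finRange a).map site := by
  refine List.Perm.eq_of_pairwise (le := (· < ·)) (fun x y _ _ h h' => absurd h h'.asymm)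
    ((List.pairwise_lt_finRange n).filter _)
    ((List.pairwise_lt_finRange a).map _ fun x y h => site.lt_iff_lt.2 h) ?_
  refine (List.perm_ext_iff_of_nodup ((List.nodup_finRange n).filter _)
    ((List.nodup_finRange a).map site.injective)).2 fun q => ?_
  simp

theorem restrict_rawTermOf (x : Bits n) :
    restrict (rawTermOf site mat).1 (bits x) = bits fun i => x (site i) := by
  rw [restrict, rawTermOf, bits, List.zip_map', List.filter_map, List.map_map]
  change List.map (fun q => eqb (x q) 1) (List.filter (fun q => decide _) _) = _
  rw [filter_finRange_support, List.map_map]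
  rfl

theorem count_rawTermOf : ((rawTermOf site mat).1.filter fun b => b).length = a := by
  rw [rawTermOf, List.filter_map, List.length_map]
  change (List.filter (fun q => decide _) _).length = a
  rw [filter_finRange_support]
  simp

theorem termPositions_eq {k : ℕ} {m : List Bool} (h : (m.filter fun b => b).length ≤ k) :
    termPositions k m = positions (m.filter fun b => b).length := by
  rw [termPositions, List.getD_eq_getElem _ _ (by simp; omega)]
  simp

theorem positions_eq (a : ℕ) : positions a =
    (List.finRange (2 ^ a) ×ˢ List.finRange (2 ^ a)).map fun p =>
      (bits (bitsOf p.1), bits (bitsOf p.2)) := by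
  simp [positions, SProd.sprod, List.product, List.map_flatMap, Function.comp_def]

theorem rawTermOf_snd : (rawTermOf site mat).2 =
    (List.finRange (2 ^ a) ×ˢ List.finRange (2 ^ a)).map fun p =>
      rawEntry (mat (bitsOf p.1) (bitsOf p.2)) := by
  simp [rawTermOf, SProd.sprod, List.product, List.map_flatMap, Function.comp_def]

theorem entries_rawTermOf {k : ℕ} (hk : a ≤ k) : entries k (rawTermOf site mat) =
    (List.finRange (2 ^ a) ×ˢ List.finRange (2 ^ a)).map fun p =>
      ((bits (bitsOf p.1), bits (bitsOf p.2)), rawEntry (mat (bitsOf p.1) (bitsOf p.2))) := by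
  rw [entries, termPositions_eq (by rwa [count_rawTermOf]), count_rawTermOf, positions_eq,
    rawTermOf_snd, List.zip_map']

/-- Row and column numbers correspond bijectively to bit strings, so each position occurs exactly
once and filtering acts as a lookup. -/
theorem filter_entries {k : ℕ} (hk : a ≤ k) (u v : Bits a) :
    ((entries k (rawTermOf site mat)).filter fun e => eqb e.1 (bits u, bits v)).map
      (fun e => e.2) = [rawEntry (mat u v)] := by
  obtain ⟨r, rfl⟩ := bitsOf_bijective.2 u
  obtain ⟨c, rfl⟩ := bitsOf_bijective.2 v
  rw [entries_rawTermOf _ _ hk, List.filter_map]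
  have h : (List.finRange (2 ^ a) ×ˢ List.finRange (2 ^ a)).filter
      ((fun e : (List Bool × List Bool) × (RawFrac × RawFrac) =>
        eqb e.1 (bits (bitsOf r), bits (bitsOf c))) ∘ fun p =>
          ((bits (bitsOf p.1), bits (bitsOf p.2)), rawEntry (mat (bitsOf p.1) (bitsOf p.2)))) =
      [(r, c)] := by
    have h₁ : ∀ p ∈ List.finRange (2 ^ a) ×ˢ List.finRange (2 ^ a),
        ((fun e : (List Bool × List Bool) × (RawFrac × RawFrac) =>
          eqb e.1 (bits (bitsOf r), bits (bitsOf c))) ∘ fun p : Fin (2 ^ a) × Fin (2 ^ a) =>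
          ((bits (bitsOf p.1), bits (bitsOf p.2)),
            rawEntry (mat (bitsOf p.1) (bitsOf p.2)))) p = (p == (r, c)) := by
      rintro ⟨r', c'⟩ -
      rw [Bool.eq_iff_iff]
      simp [bits_injective.eq_iff, bitsOf_bijective.1.eq_iff]
    rw [List.filter_congr h₁, List.filter_beq, List.count_eq_one_of_mem]
    · rfl
    · exact (List.nodup_finRange _).product (List.nodup_finRange _)
    · simp
  rw [h]
  rfl

theorem sumZero_pair (x y : Frac) : sumZero [rawFrac x, rawFrac y] = true ↔ x.val + y.val = 0 := by
  rw [sumZero_iff]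
  · simp [val_rawFrac]
  · simp [bval_den_rawFrac]

theorem sumZero_pair_neg (x y : Frac) :
    sumZero [rawFrac x, (rawFrac y).neg] = true ↔ x.val = y.val := by
  rw [sumZero_iff]
  · simp [val_rawFrac, RawFrac.val_neg, add_neg_eq_zero]
  · simp [bval_den_rawFrac, RawFrac.neg]

/-- Transposed entries are compared by value, since equal numbers may be given by different
fractions: real parts must agree and imaginary parts must cancel. -/
theorem hermOk_iff {k : ℕ} (hk : a ≤ k) :
    hermOk k (rawTermOf site mat) = true ↔ (mat.map GaussFrac.val).IsHermitian := by
  rw [hermOk, entries_rawTermOf _ _ hk, Matrix.IsHermitian.ext_iff]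
  simp only [List.all_map, List.all_eq_true, List.mem_product, List.mem_finRange, and_self,
    forall_true_left, Prod.forall, Function.comp_apply, Bool.or_eq_true, Bool.not_eq_true',
    Bool.and_eq_true, rawEntry, sumZero_pair, sumZero_pair_neg, Matrix.map_apply]
  have key : ∀ z z' : GaussFrac, star z'.val = z.val ↔
      z.re.val = z'.re.val ∧ z.im.val + z'.im.val = 0 := by
    intro z z'
    rw [Complex.ext_iff]
    simp only [GaussFrac.val, Complex.star_def, Complex.conj_re, Complex.conj_im]
    rw [Rat.cast_inj, ← Rat.cast_neg, Rat.cast_inj, neg_eq_iff_add_eq_zero,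
      add_comm, eq_comm (a := z'.re.val)]
  simp only [key]
  constructor
  · intro h x y
    obtain ⟨r, rfl⟩ := bitsOf_bijective.2 x
    obtain ⟨c, rfl⟩ := bitsOf_bijective.2 y
    rcases h r c c r with h | h
    · simp [← Bool.not_eq_true] at h
    · exact h
  · intro h r c r' c'
    by_cases hrc : r = c' ∧ c = r'
    · rw [hrc.1, hrc.2]
      exact Or.inr (h _ _)
    · left
      rw [← Bool.not_eq_true, eqb_iff, Prod.mk.injEq, bits_injective.eq_iff,
        bits_injective.eq_iff, bitsOf_bijective.1.eq_iff, bitsOf_bijective.1.eq_iff]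
      exact hrc

end Term

theorem exists_eq_flatMap {τ : Type*} {N M : ℕ} (g : List τ) (h : g.length = N * M) :
    ∃ f : Fin N → Fin M → τ,
      g = (List.finRange N).flatMap fun r => (List.finRange M).map fun c => f r c := by
  obtain ⟨f, rfl⟩ : ∃ f : Fin (N * M) → τ, List.ofFn f = g :=
    ⟨fun i => g.get (i.cast h.symm), by
      refine List.ext_getElem (by simp [h]) fun i h₁ h₂ => ?_
      simp⟩
  refine ⟨fun r c => f ⟨r * M + c, ?_⟩, ?_⟩
  · calc r * M + c < (r + 1) * M := by
          rw [Nat.add_mul, Nat.one_mul]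
          exact Nat.add_lt_add_left c.prop _
      _ ≤ N * M := Nat.mul_le_mul_right _ r.prop
  rw [List.ofFn_mul, List.flatMap_def, List.ofFn_eq_map]
  simp only [List.ofFn_eq_map]

/-- A valid description is turned back into a term: the marked positions form the support, its
increasing enumeration gives the sites, and the list of entries is cut into rows. -/
theorem termOk_iff (k n : ℕ) (t : RawTerm) :
    termOk k n t = true ↔ ∃ T : Term n, T.arity ≤ k ∧ rawTerm T = t := by
  have e : ∀ l : List Bool, (l.drop k).isEmpty = true ↔ l.length ≤ k := by
    intro l
    simp
  constructor
  · obtain ⟨m, es⟩ := t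
    simp only [termOk, Bool.and_eq_true, eqb_iff, e]
    rintro ⟨rfl, hk, hl, hf, hh⟩
    obtain ⟨gs, rfl⟩ : ∃ gs : List GaussFrac, gs.map rawEntry = es := by
      refine Set.mem_range.1 ?_
      rw [Set.range_list_map]
      intro z hz
      have := List.all_eq_true.1 hf z hz
      rw [Bool.and_eq_true, fracOk_iff, fracOk_iff] at this
      obtain ⟨⟨x, hx⟩, y, hy⟩ := this
      exact ⟨⟨x, y⟩, Prod.ext hx hy⟩
    let S : Finset (Fin m.length) := Finset.univ.filter fun q => m.get q = true
    have hm : ∀ mat, (rawTermOf (S.orderEmbOfFin rfl) mat).1 = m := by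
      intro mat
      conv_rhs => rw [← List.map_get_finRange m]
      refine List.map_congr_left fun q _ => ?_
      rw [Finset.map_orderEmbOfFin_univ]
      simp [S]
    have hS : (m.filter fun b => b).length = S.card := by
      -- The support string does not depend on the matrix, so a zero matrix serves for counting the
      -- marks.
      have h₁ := hm fun _ _ => ⟨⟨0, 1, one_pos⟩, ⟨0, 1, one_pos⟩⟩
      have h₂ := count_rawTermOf (S.orderEmbOfFin rfl)
        fun _ _ => ⟨⟨0, 1, one_pos⟩, ⟨0, 1, one_pos⟩⟩
      exact (congrArg (fun u : List Bool => (u.filter fun b => b).length) h₁).symm.trans h₂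
    rw [termPositions_eq hk, hS, positions_eq] at hl
    obtain ⟨f, hf'⟩ := exists_eq_flatMap (N := 2 ^ S.card) (M := 2 ^ S.card) gs
      (by simpa [List.length_product] using hl)
    let mat : Matrix (Bits S.card) (Bits S.card) GaussFrac := fun x y =>
      f (finFunctionFinEquiv x) (finFunctionFinEquiv y)
    have ht : rawTermOf (S.orderEmbOfFin rfl) mat = (m, gs.map rawEntry) := by
      refine Prod.ext (hm _) ?_
      rw [hf', List.map_flatMap]
      simp [rawTermOf, mat, bitsOf, Function.comp_def]
    rw [← ht, hermOk_iff _ _ (hS.symm.le.trans hk)] at hh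
    exact ⟨⟨S.card, S.orderEmbOfFin rfl, mat, hh⟩, hS.symm.le.trans hk, ht⟩
  · rintro ⟨T, hT, rfl⟩
    have hc : ((rawTerm T).1.filter fun b => b).length = T.arity := count_rawTermOf _ _
    simp only [termOk, Bool.and_eq_true, eqb_iff, e, hc]
    refine ⟨by simp [rawTerm, rawTermOf], hT, ?_, ?_, (hermOk_iff _ _ hT).2 T.herm⟩
    · rw [termPositions_eq (hc.le.trans hT), hc, positions_eq, rawTerm, rawTermOf_snd]
      simp
    · rw [rawTerm, rawTermOf_snd]
      simp only [List.all_map, List.all_eq_true, Function.comp_apply, Bool.and_eq_true, fracOk_iff]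
      exact fun p _ => ⟨⟨_, rfl⟩, ⟨_, rfl⟩⟩

theorem exists_bits_eq {n : ℕ} (w : List Bool) (h : w.length = n) : ∃ x : Bits n, bits x = w := by
  subst h
  refine ⟨fun q => if w.get q = true then 1 else 0, ?_⟩
  conv_rhs => rw [← List.map_get_finRange w]
  refine List.map_congr_left fun q _ => ?_
  change eqb (if w.get q = true then (1 : Fin 2) else 0) 1 = w.get q
  cases w.get q <;> rfl

theorem getD_bits {n : ℕ} (x : Bits n) (q : Fin n) : (bits x).getD q false = eqb (x q) 1 := by
  rw [List.getD_eq_getElem _ _ (by simp [length_bits])]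
  simp [bits]

/-! ### Entries of the Hamiltonian -/

theorem agreeOff_rawTerm {n : ℕ} (T : Term n) (x y : Bits n) :
    agreeOff (rawTerm T).1 (bits x) (bits y) = true ↔ ∀ q, q ∉ T.support → x q = y q := by
  have h : ∀ a b : Fin 2, eqb a 1 = eqb b 1 ↔ a = b := by
    intro a b
    rw [Bool.eq_iff_iff, eqb_iff, eqb_iff]
    fin_cases a <;> fin_cases b <;> simp
  rw [agreeOff, rawTerm, rawTermOf, bits, bits, List.zip_map', List.zip_map', List.all_map]
  simp only [List.all_eq_true, List.mem_finRange, forall_true_left, Function.comp_apply,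
    Bool.or_eq_true, decide_eq_true_eq, eqb_iff, h, Term.support, or_iff_not_imp_left]

/-- Because of the identity on the other qubits, a term adds one entry of its matrix if the strings
agree off its support, and nothing otherwise. -/
theorem contributions_spec {k n : ℕ} (Ts : List (Term n)) (hk : ∀ T ∈ Ts, T.arity ≤ k)
    (x y : Bits n) :
    (∀ z ∈ contributions k (n, Ts.map rawTerm) (bits x) (bits y),
      0 < bval z.1.2.2 ∧ 0 < bval z.2.2.2) ∧
    ((Ts.map Term.toMatrix).sum x y).re =
      (((contributions k (n, Ts.map rawTerm) (bits x) (bits y)).map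
        fun z => z.1.val).sum : ℚ) ∧
    ((Ts.map Term.toMatrix).sum x y).im =
      (((contributions k (n, Ts.map rawTerm) (bits x) (bits y)).map
        fun z => z.2.val).sum : ℚ) := by
  induction Ts with
  | nil => simp [contributions]
  | cons T Ts ih =>
    obtain ⟨h₀, h₁, h₂⟩ := ih fun S hS => hk S (by simp [hS])
    have e : contributions k (n, (T :: Ts).map rawTerm) (bits x) (bits y) =
        (if ∀ q, q ∉ T.support → x q = y q then
          [rawEntry (T.mat (fun i => x (T.site i)) (fun i => y (T.site i)))] else []) ++
        contributions k (n, Ts.map rawTerm) (bits x) (bits y) := by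
      rw [contributions, List.map_cons, List.flatMap_cons]
      congr 1
      rw [if_congr (agreeOff_rawTerm T x y) rfl rfl]
      congr 1
      rw [rawTerm, restrict_rawTermOf, restrict_rawTermOf, filter_entries _ _ (hk T (by simp))]
    rw [e, List.map_cons, List.sum_cons, Matrix.add_apply, Term.toMatrix, Complex.add_re,
      Complex.add_im, h₁, h₂]
    split
    · refine ⟨?_, ?_, ?_⟩
      · intro z hz
        rcases List.mem_cons.1 hz with rfl | hz
        · exact ⟨bval_den_rawFrac _, bval_den_rawFrac _⟩
        · exact h₀ z hz
      · simp [rawEntry, val_rawFrac, GaussFrac.val]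
      · simp [rawEntry, val_rawFrac, GaussFrac.val]
    · simpa using h₀

theorem entryOk_iff {k : ℕ} {H : Hamiltonian} (hk : H.IsLocal k) (x y : Bits H.n) :
    entryOk k (rawHam H) (bits x) (bits y) = true ↔
      (x ≠ y → (H.toMatrix x y).re ≤ 0 ∧ (H.toMatrix x y).im = 0) := by
  obtain ⟨h₀, h₁, h₂⟩ := contributions_spec H.terms hk x y
  rw [entryOk, rawHam, Bool.or_eq_true, Bool.and_eq_true, eqb_iff, bits_injective.eq_iff,
    sumNonpos_iff, sumZero_iff, List.map_map, List.map_map, Hamiltonian.toMatrix, h₁, h₂,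
    Rat.cast_nonpos, Rat.cast_eq_zero, or_iff_not_imp_left]
  · rfl
  · intro z hz
    obtain ⟨u, hu, rfl⟩ := List.mem_map.1 hz
    exact (h₀ u hu).2
  · intro z hz
    obtain ⟨u, hu, rfl⟩ := List.mem_map.1 hz
    exact (h₀ u hu).1

theorem Term.im_toMatrix_self {n : ℕ} (T : Term n) (x : Bits n) : (T.toMatrix x x).im = 0 := by
  have h := T.herm.apply (fun i => x (T.site i)) (fun i => x (T.site i))
  rw [Matrix.map_apply] at h
  rw [Term.toMatrix, if_pos fun _ _ => rfl]
  exact Complex.conj_eq_iff_im.1 h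

theorem Hamiltonian.im_toMatrix_self (H : Hamiltonian) (x : Bits H.n) :
    (H.toMatrix x x).im = 0 := by
  rw [Hamiltonian.toMatrix]
  induction H.terms with
  | nil => simp
  | cons T Ts ih =>
    rw [List.map_cons, List.sum_cons, Matrix.add_apply, Complex.add_im, T.im_toMatrix_self, ih,
      add_zero]

/-- Hermitian terms have a real diagonal, which is why `entryOk` may accept every diagonal position.
-/
theorem globallyStoquastic_iff (H : Hamiltonian) : GloballyStoquastic H.toMatrix ↔
    ∀ x y, x ≠ y → (H.toMatrix x y).re ≤ 0 ∧ (H.toMatrix x y).im = 0 := by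
  refine ⟨fun h x y hxy => ⟨h.2 x y hxy, h.1 x y⟩, fun h => ⟨fun x y => ?_, fun x y hxy =>
    (h x y hxy).1⟩⟩
  by_cases hxy : x = y
  · rw [hxy, H.im_toMatrix_self]
  · exact (h x y hxy).2

/-! ### Neighborhoods -/

/-- The qubits that share a term with qubit `i`. -/
noncomputable def Hamiltonian.neighbors (H : Hamiltonian) (i : Fin H.n) : Finset (Fin H.n) :=
  open Classical in Finset.univ.filter fun j => ∃ t ∈ H.terms, i ∈ t.support ∧ j ∈ t.support

theorem Hamiltonian.mem_neighbors {H : Hamiltonian} {i j : Fin H.n} :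
    j ∈ H.neighbors i ↔ ∃ t ∈ H.terms, i ∈ t.support ∧ j ∈ t.support := by
  simp [neighbors]

/-- A qubit on which some term acts is its own neighbor, which accounts for the extra one; otherwise
the neighborhood is empty. -/
theorem Hamiltonian.degreeLE_iff (H : Hamiltonian) (l : ℕ) :
    H.DegreeLE l ↔ ∀ i, (H.neighbors i).card ≤ l + 1 := by
  classical
  refine forall_congr' fun i => ?_
  have h : {j | H.Interacts i j} = ((H.neighbors i).erase i : Finset (Fin H.n)) := by
    ext j
    simp [Interacts, mem_neighbors, eq_comm (a := i), and_comm]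
  rw [h, Set.ncard_coe_finset]
  by_cases hi : i ∈ H.neighbors i
  · rw [Finset.card_erase_of_mem hi]
    omega
  · have : H.neighbors i = ∅ := by
      refine Finset.eq_empty_of_forall_notMem fun j hj => hi ?_
      obtain ⟨t, ht, hit, -⟩ := mem_neighbors.1 hj
      exact mem_neighbors.2 ⟨t, ht, hit, hit⟩
    simp [this]

/-- The bits of `x` at the positions in `S`, and zeros elsewhere. -/
def mask {n : ℕ} (S : Finset (Fin n)) (x : Bits n) : Bits n := fun q => if q ∈ S then x q else 0

/-- If two basis states differ at `i` but not outside the support of some term, then their matrix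
entry depends only on the bits in the neighborhood of `i`. -/
theorem Hamiltonian.toMatrix_mask (H : Hamiltonian) {x y : Bits H.n} {i : Fin H.n}
    (hi : x i ≠ y i) {t : Term H.n} (ht : t ∈ H.terms) (hxy : ∀ q, q ∉ t.support → x q = y q) :
    H.toMatrix (mask (H.neighbors i) x) (mask (H.neighbors i) y) = H.toMatrix x y := by
  -- A contributing term must act on `i`, where the strings differ, so all its qubits are neighbors
  -- of `i`.
  have hsub : ∀ T ∈ H.terms, (∀ q, q ∉ T.support → x q = y q) → ∀ q ∈ T.support,
      q ∈ H.neighbors i := fun T hT h q hq =>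
    mem_neighbors.2 ⟨T, hT, not_not.1 fun h' => hi (h i h'), hq⟩
  -- Masking could only destroy a difference outside the neighborhood, and the contributing term `t`
  -- shows that there is none. So the same terms contribute before and after.
  have hmask : ∀ q, mask (H.neighbors i) x q = mask (H.neighbors i) y q ↔ x q = y q := by
    intro q
    rw [mask, mask]
    split
    · rfl
    · next hq => exact iff_of_true rfl (hxy q fun h => hq (hsub t ht hxy q h))
  have key : ∀ T ∈ H.terms,
      T.toMatrix (mask (H.neighbors i) x) (mask (H.neighbors i) y) = T.toMatrix x y := by
    intro T hT
    rw [Term.toMatrix, Term.toMatrix]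
    simp only [hmask]
    split
    · next h =>
      have hs : ∀ j, T.site j ∈ H.neighbors i := fun j =>
        hsub T hT h _ (Finset.mem_map_of_mem _ (Finset.mem_univ j))
      simp only [mask, hs, if_true]
    · rfl
  rw [Hamiltonian.toMatrix]
  generalize H.terms = Ts at key
  induction Ts with
  | nil => rfl
  | cons T Ts ih =>
    rw [List.map_cons, List.sum_cons, Matrix.add_apply, Matrix.add_apply, key T (by simp),
      ih fun T hT => key T (by simp [hT])]

theorem Hamiltonian.toMatrix_eq_zero (H : Hamiltonian) {x y : Bits H.n}
    (h : ∀ t ∈ H.terms, ¬ ∀ q, q ∉ t.support → x q = y q) : H.toMatrix x y = 0 := by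
  rw [Hamiltonian.toMatrix]
  generalize H.terms = Ts at h
  induction Ts with
  | nil => rfl
  | cons T Ts ih =>
    rw [List.map_cons, List.sum_cons, Matrix.add_apply, ih fun T hT => h T (by simp [hT]),
      Term.toMatrix, if_neg (h T (by simp)), add_zero]

/-- An off-diagonal entry either vanishes for lack of contributing terms or equals the masked entry
at a qubit where the strings differ. -/
theorem globallyStoquastic_of_mask (H : Hamiltonian)
    (h : ∀ i x y, mask (H.neighbors i) x ≠ mask (H.neighbors i) y →
      (H.toMatrix (mask (H.neighbors i) x) (mask (H.neighbors i) y)).re ≤ 0 ∧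
        (H.toMatrix (mask (H.neighbors i) x) (mask (H.neighbors i) y)).im = 0) :
    GloballyStoquastic H.toMatrix := by
  refine (globallyStoquastic_iff H).2 fun x y hxy => ?_
  obtain ⟨i, hi⟩ := Function.ne_iff.1 hxy
  by_cases ht : ∃ t ∈ H.terms, ∀ q, q ∉ t.support → x q = y q
  · obtain ⟨t, ht, htxy⟩ := ht
    rw [← H.toMatrix_mask hi ht htxy]
    -- The masked strings still differ at `i`, which is its own neighbor.
    refine h i x y fun hm => hi ?_
    have hit : i ∈ t.support := not_not.1 fun h' => hi (htxy i h')
    have := congrFun hm i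
    rwa [mask, mask, if_pos (Hamiltonian.mem_neighbors.2 ⟨t, ht, hit, hit⟩),
      if_pos (Hamiltonian.mem_neighbors.2 ⟨t, ht, hit, hit⟩)] at this
  · rw [H.toMatrix_eq_zero fun t h₁ h₂ => ht ⟨t, h₁, h₂⟩]
    simp

/-! ### The checks for one qubit -/

theorem hood_rawHam (H : Hamiltonian) (i : Fin H.n) :
    hood (rawHam H) i = (List.finRange H.n).map fun j => decide (j ∈ H.neighbors i) := by
  rw [hood, rawHam]
  dsimp only
  rw [← List.map_coe_finRange_eq_range, List.map_map]
  refine List.map_congr_left fun j _ => ?_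
  have h : ∀ (T : Term H.n) (q : Fin H.n),
      (rawTerm T).1.getD q false = decide (q ∈ T.support) := by
    intro T q
    rw [List.getD_eq_getElem _ _ (by simp [rawTerm, rawTermOf])]
    simp [rawTerm, rawTermOf, Term.support]
  rw [Bool.eq_iff_iff]
  simp [Hamiltonian.mem_neighbors, h, -List.getD_eq_getElem?_getD]

theorem length_filter_hood (H : Hamiltonian) (i : Fin H.n) :
    ((hood (rawHam H) i).filter fun b => b).length = (H.neighbors i).card := by
  rw [hood_rawHam, List.filter_map, List.length_map]
  change (List.filter (fun q => decide _) _).length = _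
  rw [← List.toFinset_card_of_nodup ((List.nodup_finRange _).filter _)]
  congr 1
  ext
  simp

theorem mem_allBits {m : ℕ} {b : List Bool} : b ∈ allBits m ↔ b.length = m := by
  rw [allBits, List.mem_map]
  constructor
  · rintro ⟨f, -, rfl⟩
    simp
  · rintro rfl
    exact ⟨b.get, by simp, by simp⟩

/-- The bits of `u` at the marked positions, padded to length `a`, do the job, as `zip` ignores the
padding. One fixed length thus serves neighborhoods of every admissible size. -/
theorem exists_spread_eq {m u : List Bool} {a : ℕ} (hm : (m.filter fun b => b).length ≤ a)
    (hu : u.length = m.length) (h : ∀ j, u.getD j false = true → m.getD j false = true) :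
    ∃ b ∈ allBits a, spread m b = u := by
  set P := (List.range m.length).filter fun i => m.getD i false with hP
  have hPl : P.length = (m.filter fun b => b).length := by
    have : m = (List.range m.length).map fun i => m.getD i false := by
      refine List.ext_getElem (by simp) fun i h₁ h₂ => ?_
      simp [h₁]
    conv_rhs => rw [this, List.filter_map, List.length_map]
    rfl
  refine ⟨P.map (fun i => u.getD i false) ++ List.replicate (a - P.length) false,
    mem_allBits.2 (by rw [List.length_append, List.length_map, List.length_replicate]; omega), ?_⟩
  have hz : P.zip (P.map (fun i => u.getD i false) ++ List.replicate (a - P.length) false) =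
      P.map fun i => (i, u.getD i false) := by
    refine List.ext_getElem (by simp) fun i h₁ h₂ => ?_
    have hi : i < P.length := by simpa using h₂
    simp [hi]
  rw [spread, ← hP, hz]
  refine List.ext_getElem (by simp [hu]) fun j h₁ h₂ => ?_
  have hj : u[j] = u.getD j false := (List.getD_eq_getElem _ _ h₂).symm
  rw [hj, List.getElem_map, List.getElem_range, List.any_map, Bool.eq_iff_iff, List.any_eq_true]
  constructor
  · rintro ⟨p, -, hp⟩
    rw [Function.comp_apply, Bool.and_eq_true, eqb_iff] at hp
    rw [← hp.1]
    exact hp.2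
  · intro huj
    refine ⟨j, List.mem_filter.2 ⟨List.mem_range.2 (hu ▸ h₂), h j huj⟩, ?_⟩
    rw [Function.comp_apply, Bool.and_eq_true, eqb_iff]
    exact ⟨rfl, huj⟩

theorem qubitOk_iff (k l : ℕ) (r : RawHam) (i : ℕ) : qubitOk k l r i = true ↔
    ((hood r i).filter fun b => b).length ≤ l + 1 ∧
      ∀ b ∈ allBits (l + 1), ∀ b' ∈ allBits (l + 1),
        entryOk k r (spread (hood r i) b) (spread (hood r i) b') = true := by
  simp only [qubitOk, Bool.and_eq_true, List.all_eq_true]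
  refine and_congr_left fun _ => ?_
  simp

/-- If the checks succeed, the degree bound makes every masked string a spread, so all masked
entries have been tested. Conversely every spread is a basis state, so each check is an instance of
stoquasticity. -/
theorem forall_qubitOk_iff {k : ℕ} (l : ℕ) {H : Hamiltonian} (hk : H.IsLocal k) :
    (∀ i < H.n, qubitOk k l (rawHam H) i = true) ↔
      H.DegreeLE l ∧ GloballyStoquastic H.toMatrix := by
  rw [H.degreeLE_iff]
  have hlen : ∀ i : Fin H.n, (hood (rawHam H) i).length = H.n := by
    intro i
    rw [hood_rawHam, List.length_map, List.length_finRange]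
  constructor
  · intro h
    refine ⟨fun i => ?_, globallyStoquastic_of_mask H fun i x y => ?_⟩
    · rw [← length_filter_hood]
      exact ((qubitOk_iff k l _ _).1 (h i i.prop)).1
    · obtain ⟨h₁, h₂⟩ := (qubitOk_iff k l _ _).1 (h i i.prop)
      have key : ∀ x : Bits H.n, ∃ b ∈ allBits (l + 1),
          spread (hood (rawHam H) i) b = bits (mask (H.neighbors i) x) := by
        intro x
        refine exists_spread_eq h₁ (by rw [length_bits, hlen]) fun j hj => ?_
        have hjn : j < H.n := by
          by_contra hjn
          rw [List.getD_eq_default _ _ (by rw [length_bits]; omega)] at hj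
          exact absurd hj (by simp)
        have h₃ := getD_bits (mask (H.neighbors i) x) ⟨j, hjn⟩
        have h₄ : (hood (rawHam H) i).getD j false =
            decide ((⟨j, hjn⟩ : Fin H.n) ∈ H.neighbors i) := by
          rw [List.getD_eq_getElem _ _ (by rw [hlen]; exact hjn)]
          simp [hood_rawHam]
        rw [h₃, eqb_iff, mask] at hj
        rw [h₄, decide_eq_true_eq]
        by_contra hn
        rw [if_neg hn] at hj
        exact absurd hj (by decide)
      obtain ⟨b, hb, hbx⟩ := key x
      obtain ⟨b', hb', hby⟩ := key y
      have := h₂ b hb b' hb'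
      rw [hbx, hby] at this
      exact (entryOk_iff hk _ _).1 this
  · rintro ⟨hd, hs⟩ i hi
    refine (qubitOk_iff k l _ _).2 ⟨(length_filter_hood H ⟨i, hi⟩).trans_le (hd _), ?_⟩
    intro b _ b' _
    have hsp : ∀ b, ∃ x : Bits H.n, bits x = spread (hood (rawHam H) i) b := fun b =>
      exists_bits_eq _ (by
        rw [spread, List.length_map, List.length_range]
        exact hlen ⟨i, hi⟩)
    obtain ⟨x, hx⟩ := hsp b
    obtain ⟨y, hy⟩ := hsp b'
    rw [← hx, ← hy]
    exact (entryOk_iff hk x y).2 ((globallyStoquastic_iff H).1 hs x y)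

theorem hamOk_iff (k l : ℕ) (r : RawHam) : hamOk k l r = true ↔
    ∃ H : Hamiltonian, rawHam H = r ∧ H.IsLocal k ∧ H.DegreeLE l ∧
      GloballyStoquastic H.toMatrix := by
  simp only [hamOk, Bool.and_eq_true, List.all_eq_true, List.mem_range]
  constructor
  · rintro ⟨ht, hq⟩
    obtain ⟨n, ts⟩ := r
    obtain ⟨Ts, rfl⟩ : ∃ Ts : List {T : Term n // T.arity ≤ k},
        Ts.map (fun T => rawTerm T.1) = ts := by
      refine Set.mem_range.1 ?_
      rw [Set.range_list_map]
      intro t h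
      obtain ⟨T, hT, hTt⟩ := (termOk_iff k n t).1 (ht t h)
      exact ⟨⟨T, hT⟩, hTt⟩
    have hH : rawHam ⟨n, Ts.map Subtype.val⟩ = (n, Ts.map fun T => rawTerm T.1) := by
      rw [rawHam, List.map_map]
      rfl
    have hk : Hamiltonian.IsLocal k ⟨n, Ts.map Subtype.val⟩ := by
      intro T hT
      obtain ⟨T, -, rfl⟩ := List.mem_map.1 hT
      exact T.2
    rw [← hH] at hq
    exact ⟨_, hH, hk, (forall_qubitOk_iff l hk).1 hq⟩
  · rintro ⟨H, rfl, hk, h⟩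
    refine ⟨fun t ht => ?_, (forall_qubitOk_iff l hk).2 h⟩
    obtain ⟨T, hT, rfl⟩ := List.mem_map.1 ht
    exact (termOk_iff k _ _).2 ⟨T, hk T hT, rfl⟩

theorem decideStoq_iff_mem (k l : ℕ) (w : List Letter) :
    decideStoq k l w = true ↔ w ∈ GlobalStoq k l := by
  rw [decideStoq_iff]
  constructor
  · rintro ⟨r, rfl, h⟩
    obtain ⟨H, rfl, hH⟩ := (hamOk_iff k l r).1 h
    exact ⟨H, (encodeHam_rawHam H).symm, hH⟩
  · rintro ⟨H, rfl, hH⟩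
    exact ⟨rawHam H, encodeHam_rawHam H, (hamOk_iff k l _).2 ⟨H, rfl, hH⟩⟩

end LocalHam

theorem proposition4 (k l : ℕ) : InP (LocalHam.GlobalStoq k l) := by
  classical
  have h : (fun w => decide (w ∈ LocalHam.GlobalStoq k l)) = LocalHam.decideStoq k l := by
    funext w
    rw [Bool.eq_iff_iff, decide_eq_true_eq, LocalHam.decideStoq_iff_mem]
  rw [InP]
  -- The machine receives its input reversed, so the program starts by reversing it.
  convert StackProg.PolyTime.turing (f := LocalHam.decideStoq k l)
    (LocalHam.polyTime_decideStoq k l (StackProg.PolyTime.reverse StackProg.PolyTime.id)) using 2
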